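/- Let $0\le p\le n$ be integers and let $\mathcal O(p,n)=\{U_1\in\mathbb R^{n\times p}: U_1^{\mathsf T}U_1=I_p\}$ be the Stiefel manifold of real $n\times p$ matrices with orthonormal columns. For $U_1\in\mathcal O(p,n)$ let $u_1,\dots,u_n$ be the columns of an orthogonal matrix $[U_1\ U_2]$ that extends $U_1$. Consider on $\mathcal O(p,n)$ the density (signs are ignored) $$\Bigl|\bigwedge_{j=1}^p\bigwedge_{i=j+1}^n\langle u_i,\mathrm du_j\rangle\Bigr|,$$ which does not depend on the choice of $U_2$; it is integrated in local parametrizations, that is, if $\varphi:\Omega\to\mathcal O(p,n)$ is an injective $C^1$ map on an open set $\Omega\subset\mathbb R^d$, $d=\#\{(i,j): 1\le j\le p,\ j<i\le n\}$, then the integral over a Borel set $A\subset\varphi(\Omega)$ is $\int_{\varphi^{-1}(A)}\bigl|\det\bigl(\langle u_i,\partial_k\varphi_j(x)\rangle\bigr)_{(i,j),k}\bigr|\,\mathrm dx$, where $\varphi_j$ is the $j$-th column of $\varphi$ and $u_i$ are the columns of an orthogonal matrix extending $\varphi(x)$. These local integrals are consistent, i.e. they are the restrictions of one Borel measure on $\mathcal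 O(p,n)$ (the least one dominating all of them), and the total integral is $$\int_{\mathcal O(p,n)}\bigwedge_{j=1}^p\bigwedge_{i=j+1}^n\langle u_i,\mathrm du_j\rangle=\frac{2^p\,\pi^{pn/2}}{\Gamma_p\left(\frac n2\right)},\qquad \Gamma_p(\alpha)=\pi^{p(p-1)/4}\,\Gamma(\alpha)\,\Gamma\left(\alpha-\tfrac12\right)\cdots\Gamma\left(\alpha-\tfrac{p-1}2\right).$$ Moreover, for $p=n$, the normalized measure $\mathrm d\mu(V)=\dfrac{\Gamma_n(n/2)}{2^n\pi^{n^2/2}}\bigwedge_{i>j}\langle v_i,\mathrm dv_j\rangle$ on the orthogonal group $\mathcal O(n)$ is a probability measure, it is a Haar measure, and it is invariant under $V\mapsto UVW$ for all $U,W\in\mathcal O(n)$. -/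

import Mathlib

open MeasureTheory
open scoped Matrix.Norms.Elementwise

noncomputable section

namespace StiefelVolume

/-- The Borel `σ`-algebra on real matrices (the product one on the entries). -/
instance instMeasurableSpaceMatrix (m n : ℕ) : MeasurableSpace (Matrix (Fin m) (Fin n) ℝ) :=
  inferInstanceAs (MeasurableSpace (Fin m → Fin n → ℝ))

instance instBorelSpaceMatrix (m n : ℕ) : BorelSpace (Matrix (Fin m) (Fin n) ℝ) :=
  inferInstanceAs (BorelSpace (Fin m → Fin n → ℝ))

/-- The same fact for the topology that comes from the (elementwise) norm on matrices. -/
instance instBorelSpaceMatrixNorm (m n : ℕ) :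
    @BorelSpace (Matrix (Fin m) (Fin n) ℝ)
      (PseudoMetricSpace.toUniformSpace (α := Matrix (Fin m) (Fin n) ℝ)).toTopologicalSpace
      (instMeasurableSpaceMatrix m n) :=
  inferInstanceAs (BorelSpace (Fin m → Fin n → ℝ))

/-- The multivariate gamma function
`Γ_p(α) = π^{p(p-1)/4} Γ(α) Γ(α - 1/2) ⋯ Γ(α - (p-1)/2)`. -/
def multiGamma (p : ℕ) (α : ℝ) : ℝ :=
  Real.pi ^ ((p : ℝ) * ((p : ℝ) - 1) / 4) * ∏ j : Fin p, Real.Gamma (α - (j : ℝ) / 2)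

/-- The Stiefel manifold of `n × p` matrices with orthonormal columns. -/
def stiefel (n p : ℕ) : Set (Matrix (Fin n) (Fin p) ℝ) :=
  {U | U.transpose * U = 1}

/-- The wedge product of a finite family of linear forms, with the normalisation
`(⋀ α_a)(v) = det (α_a (v_b))`. -/
def wedge {κ E : Type*} [Fintype κ] [DecidableEq κ] [AddCommGroup E] [Module ℝ E]
    (α : κ → E →ₗ[ℝ] ℝ) : E [⋀^κ]→ₗ[ℝ] ℝ :=
  Matrix.detRowAlternating.compLinearMap (LinearMap.pi α)

/-- The pairs `(i, j)`, `i < n`, `j < p`, with `i > j`. -/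
abbrev Pairs (n p : ℕ) : Type := {a : Fin n × Fin p // (a.2 : ℕ) < (a.1 : ℕ)}

/-- The linear form `⟨u_i, du_j⟩` on `n × p` matrices: `u_i` is the `i`-th column of the square
matrix `V`, and `du_j` extracts the `j`-th column of a tangent vector. -/
def innerForm {n p : ℕ} (V : Matrix (Fin n) (Fin n) ℝ) (i : Fin n) (j : Fin p) :
    Matrix (Fin n) (Fin p) ℝ →ₗ[ℝ] ℝ where
  toFun X := ∑ k, V k i * X k j
  map_add' X Y := by simp [mul_add, Finset.sum_add_distrib]
  map_smul' c X := by simp [Finset.mul_sum, mul_left_comm]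

/-- The form `⋀_{j ≤ p} ⋀_{j < i ≤ n} ⟨u_i, du_j⟩`, where `u_1, …, u_n` are the columns of `V`. -/
def stiefelForm {n : ℕ} (p : ℕ) (V : Matrix (Fin n) (Fin n) ℝ) :
    Matrix (Fin n) (Fin p) ℝ [⋀^Pairs n p]→ₗ[ℝ] ℝ :=
  wedge fun a : Pairs n p => innerForm V a.1.1 a.1.2

/-- `V = [U U₂]` is an orthogonal matrix whose first `p` columns are those of `U`. -/
def IsCompletion {n p : ℕ} (h : p ≤ n) (U : Matrix (Fin n) (Fin p) ℝ)
    (V : Matrix (Fin n) (Fin n) ℝ) : Prop :=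
  V ∈ Matrix.orthogonalGroup (Fin n) ℝ ∧ ∀ i j, V i (Fin.castLE h j) = U i j

/-- A chosen orthogonal completion `[U U₂]` of `U`. -/
def completion {n p : ℕ} (h : p ≤ n) (U : Matrix (Fin n) (Fin p) ℝ) : Matrix (Fin n) (Fin n) ℝ :=
  Classical.epsilon (IsCompletion h U)

theorem completion_spec {n p : ℕ} (h : p ≤ n) {U : Matrix (Fin n) (Fin p) ℝ}
    (hU : U ∈ stiefel n p) : IsCompletion h U (completion h U) := by
  refine Classical.epsilon_spec (p := IsCompletion h U) ?_
  let v : Fin n → EuclideanSpace ℝ (Fin n) := fun i =>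
    if hi : (i : ℕ) < p then WithLp.toLp 2 (fun k => U k ⟨i, hi⟩) else 0
  let s : Set (Fin n) := {i | (i : ℕ) < p}
  have hv : Orthonormal ℝ (s.domRestrict v) := by
    rw [orthonormal_iff_ite]
    rintro ⟨i, hi⟩ ⟨j, hj⟩
    have hi' : (i : ℕ) < p := hi
    have hj' : (j : ℕ) < p := hj
    have key := congrFun (congrFun hU ⟨i, hi'⟩) ⟨j, hj'⟩
    simp only [Matrix.mul_apply, Matrix.transpose_apply, Matrix.one_apply, Fin.mk.injEq] at key
    simp only [Set.domRestrict_apply, v, hi', hj', dif_pos, PiLp.inner_apply, Subtype.mk.injEq,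
      Fin.ext_iff]
    rw [← key]
    exact Finset.sum_congr rfl fun k _ => by simp [mul_comm]
  obtain ⟨b, hb⟩ := hv.exists_orthonormalBasis_extension_of_card_eq (by simp)
  refine ⟨Matrix.of fun k i => b i k, ?_, fun i j => ?_⟩
  · rw [Matrix.mem_orthogonalGroup_iff']
    ext i j
    have := (orthonormal_iff_ite.mp b.orthonormal) i j
    rw [PiLp.inner_apply] at this
    simp only [Matrix.mul_apply, Matrix.transpose_apply, Matrix.of_apply, Matrix.one_apply]
    rw [← this]
    exact Finset.sum_congr rfl fun k _ => by simp [mul_comm]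
  · have := hb (Fin.castLE h j) (by simp [s])
    simp [this, v]

/-- The absolute value of `⋀ ⟨u_i, du_j⟩` does not depend on the completion `[U U₂]`. -/
theorem abs_stiefelForm_eq {n p : ℕ} (h : p ≤ n) {U : Matrix (Fin n) (Fin p) ℝ}
    {V V' : Matrix (Fin n) (Fin n) ℝ} (hV : IsCompletion h U V) (hV' : IsCompletion h U V')
    (v : Pairs n p → Matrix (Fin n) (Fin p) ℝ) :
    |stiefelForm p V v| = |stiefelForm p V' v| := by
  have oV := (Matrix.mem_orthogonalGroup_iff' (Fin n) ℝ).mp hV.1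
  have oV1 := (Matrix.mem_orthogonalGroup_iff (Fin n) ℝ).mp hV.1
  have oV1' := (Matrix.mem_orthogonalGroup_iff (Fin n) ℝ).mp hV'.1
  have hcol : ∀ (j : Fin n), (j : ℕ) < p → ∀ k, V k j = V' k j := fun j hj k => by
    have e : j = Fin.castLE h ⟨j, hj⟩ := rfl
    rw [e, hV.2, hV'.2]
  let W : Matrix (Fin n) (Fin n) ℝ := V.transpose * V'
  have hW : W.transpose * W = 1 := by
    have o' := (Matrix.mem_orthogonalGroup_iff' (Fin n) ℝ).mp hV'.1
    simp only [W, Matrix.transpose_mul, Matrix.transpose_transpose]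
    rw [Matrix.mul_assoc, ← Matrix.mul_assoc V, oV1, Matrix.one_mul, o']
  have hVW : V.transpose = W * V'.transpose := by
    simp only [W]
    rw [Matrix.mul_assoc, oV1', Matrix.mul_one]
  -- `W` is the identity on the first `p` coordinates
  have hW0 : ∀ i l : Fin n, (l : ℕ) < p → l ≠ i → W i l = 0 := fun i l hl hli => by
    have : W i l = (V.transpose * V) i l := by
      simp only [W, Matrix.mul_apply]
      exact Finset.sum_congr rfl fun k _ => by rw [hcol l hl]
    rw [this, oV, Matrix.one_apply_ne hli.symm]
  have hW0' : ∀ i l : Fin n, (i : ℕ) < p → l ≠ i → W i l = 0 := fun i l hi hli => by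
    have o' := (Matrix.mem_orthogonalGroup_iff' (Fin n) ℝ).mp hV'.1
    have : W i l = (V'.transpose * V') i l := by
      simp only [W, Matrix.mul_apply, Matrix.transpose_apply]
      exact Finset.sum_congr rfl fun k _ => by rw [hcol i hi]
    rw [this, o', Matrix.one_apply_ne hli.symm]
  let A : Matrix (Fin n) (Fin n) ℝ → Matrix (Pairs n p) (Pairs n p) ℝ := fun Z =>
    Matrix.of fun a b => innerForm Z a.1.1 a.1.2 (v b)
  let N : Matrix (Pairs n p) (Pairs n p) ℝ := Matrix.of fun a b =>
    if a.1.2 = b.1.2 then W a.1.1 b.1.1 else 0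
  have hsum : ∀ (j : Fin p) (f : Fin n → ℝ), (∀ l : Fin n, (l : ℕ) ≤ j → f l = 0) →
      ∑ b : Pairs n p, (if b.1.2 = j then f b.1.1 else 0) = ∑ l, f l := by
    intro j f hf
    have h1 : ∑ b : Pairs n p, (if b.1.2 = j then f b.1.1 else 0) =
        ∑ a : Fin n × Fin p, if (a.2 : ℕ) < (a.1 : ℕ) then (if a.2 = j then f a.1 else 0) else 0 := by
      rw [← Finset.sum_filter (fun a : Fin n × Fin p => (a.2 : ℕ) < (a.1 : ℕ))]
      exact (Finset.sum_subtype (p := fun a : Fin n × Fin p => (a.2 : ℕ) < (a.1 : ℕ))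
        (Finset.univ.filter fun a : Fin n × Fin p => (a.2 : ℕ) < (a.1 : ℕ)) (by simp) (fun a => if a.2 = j then f a.1 else 0)).symm
    rw [h1, Fintype.sum_prod_type]
    refine Finset.sum_congr rfl fun l _ => ?_
    rw [Finset.sum_eq_single j]
    · by_cases hl : (j : ℕ) < l
      · simp [hl]
      · simp [hl, hf l (not_lt.mp hl)]
    · intro c _ hc
      simp [hc]
    · simp
  have hA : A V = N * A V' := by
    ext a b
    rw [Matrix.mul_apply]
    have e1 : ∀ c : Pairs n p, N a c * A V' c b =
        if c.1.2 = a.1.2 then W a.1.1 c.1.1 * innerForm V' c.1.1 a.1.2 (v b) else 0 := by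
      intro c
      by_cases hc : c.1.2 = a.1.2
      · simp [N, A, hc]
      · simp [N, hc, Ne.symm hc]
    simp_rw [e1]
    rw [hsum a.1.2 (fun l => W a.1.1 l * innerForm V' l a.1.2 (v b))]
    · have e2 : ∀ (Z : Matrix (Fin n) (Fin n) ℝ) (i : Fin n) (j : Fin p),
          innerForm Z i j (v b) = (Z.transpose * v b) i j := fun Z i j => by
        simp [innerForm, Matrix.mul_apply]
      simp only [A, Matrix.of_apply, e2]
      rw [hVW, Matrix.mul_assoc, Matrix.mul_apply]
    · intro l hl
      have hla : l ≠ a.1.1 := fun hh => by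
        have := a.2
        rw [← hh] at this
        omega
      rw [hW0 _ _ (lt_of_le_of_lt hl a.1.2.2) hla, zero_mul]
  have hN : N.transpose * N = 1 := by
    ext a b
    rw [Matrix.mul_apply]
    by_cases hab : a.1.2 = b.1.2
    · have e1 : ∀ c : Pairs n p, N.transpose a c * N c b =
          if c.1.2 = b.1.2 then W c.1.1 a.1.1 * W c.1.1 b.1.1 else 0 := by
        intro c
        by_cases hc : c.1.2 = b.1.2 <;> simp [N, hc, hab]
      simp_rw [e1]
      rw [hsum b.1.2 (fun l => W l a.1.1 * W l b.1.1)]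
      · have := congrFun (congrFun hW a.1.1) b.1.1
        rw [Matrix.mul_apply] at this
        simp only [Matrix.transpose_apply] at this
        rw [this]
        simp only [Matrix.one_apply]
        congr 1
        rw [Subtype.ext_iff, Prod.ext_iff]
        simp [hab]
      · intro l hl
        have hla : b.1.1 ≠ l := fun hh => by
          have := b.2
          rw [hh] at this
          omega
        rw [hW0' l b.1.1 (lt_of_le_of_lt hl b.1.2.2) hla, mul_zero]
    · rw [Matrix.one_apply_ne (fun hh => hab (by rw [hh]))]
      refine Finset.sum_eq_zero fun c _ => ?_
      by_cases hc : c.1.2 = a.1.2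
      · have : c.1.2 ≠ b.1.2 := fun h2 => hab (hc.symm.trans h2)
        simp [N, this]
      · simp [N, hc]
  have hdet : |N.det| = 1 := by
    have := congrArg Matrix.det hN
    rw [Matrix.det_mul, Matrix.det_transpose, Matrix.det_one] at this
    rcases mul_self_eq_one_iff.mp this with h1 | h1 <;> simp [h1]
  have hform : ∀ Z : Matrix (Fin n) (Fin n) ℝ, stiefelForm p Z v = (A Z).det := fun Z => by
    rw [← Matrix.det_transpose]
    rfl
  rw [hform, hform, hA, Matrix.det_mul, abs_mul, hdet, one_mul]

/-- The density `|⋀_{j ≤ p} ⋀_{j < i ≤ n} ⟨u_i, du_j⟩|` at the point `U` (signs are ignored),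
evaluated on a tuple of tangent vectors; `u_1, …, u_n` are the columns of a completion of `U`. -/
def stiefelDensity {n p : ℕ} (h : p ≤ n) (U : Matrix (Fin n) (Fin p) ℝ)
    (v : Pairs n p → Matrix (Fin n) (Fin p) ℝ) : ℝ :=
  |stiefelForm p (completion h U) v|

/-- `φ` is an injective `C¹` parametrization, defined on the open set `Ω` of the coordinate space
`κ → ℝ`, of a piece of `M`. (Critical points are harmless: densities pull back to zero there.) -/
structure IsParam {κ E : Type*} [Fintype κ] [NormedAddCommGroup E] [NormedSpace ℝ E]
    (M : Set E) (Ω : Set (κ → ℝ)) (φ : (κ → ℝ) → E) : Prop where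
  isOpen : IsOpen Ω
  contDiffOn : ContDiffOn ℝ 1 φ Ω
  injOn : Set.InjOn φ Ω
  mapsTo : Set.MapsTo φ Ω M

/-- The measure on `φ(Ω)` given by a density `δ` in the coordinates `φ`:
`A ↦ ∫_{Ω ∩ φ⁻¹(A)} δ_{φ(x)}(∂₁φ(x), …, ∂_dφ(x)) dx`. -/
def paramMeasure {κ E : Type*} [Fintype κ] [DecidableEq κ] [NormedAddCommGroup E]
    [NormedSpace ℝ E] [MeasurableSpace E] (δ : E → (κ → E) → ℝ) (Ω : Set (κ → ℝ))
    (φ : (κ → ℝ) → E) : Measure E :=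
  ((volume.restrict Ω).withDensity fun x =>
    ENNReal.ofReal (δ (φ x) fun a => fderiv ℝ φ x (Pi.single a 1))).map φ

/-- Integration of the density `δ` over the manifold `M`, as a measure: the measures given by `δ`
in local coordinates are glued together, by taking their least upper bound among measures. -/
def densityMeasure {κ E : Type*} [Fintype κ] [DecidableEq κ] [NormedAddCommGroup E]
    [NormedSpace ℝ E] [MeasurableSpace E] (M : Set E) (δ : E → (κ → E) → ℝ) : Measure E :=
  sSup {μ | ∃ (Ω : Set (κ → ℝ)) (φ : (κ → ℝ) → E), IsParam M Ω φ ∧ μ = paramMeasure δ Ω φ}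

/-- The measure `A ↦ ∫_A ⋀_{j ≤ p} ⋀_{j < i ≤ n} ⟨u_i, du_j⟩` on the Stiefel manifold, as a measure
on the ambient space of `n × p` matrices. -/
def stiefelMeasure {n p : ℕ} (h : p ≤ n) : Measure (Matrix (Fin n) (Fin p) ℝ) :=
  densityMeasure (stiefel n p) (stiefelDensity h)

/-- The normalized measure
`dμ(V) = (Γ_n(n/2) / (2^n π^{n²/2})) ⋀_{i > j} ⟨v_i, dv_j⟩` on the orthogonal group. -/
def orthogonalMeasure (n : ℕ) : Measure (Matrix.orthogonalGroup (Fin n) ℝ) :=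
  ENNReal.ofReal (multiGamma n ((n : ℝ) / 2) / (2 ^ n * Real.pi ^ ((n : ℝ) ^ 2 / 2))) •
    (stiefelMeasure (le_refl n)).comap Subtype.val

end StiefelVolume

end

noncomputable section

namespace StiefelVolume

/-- The pairs `(i, j)`, `i < n`, `j < p`, with `i ≤ j`. -/
abbrev UpPairs (n p : ℕ) : Type := {a : Fin n × Fin p // ¬ (a.2 : ℕ) < (a.1 : ℕ)}

/-- The upper triangular matrix with the given entries. -/
def upTri {n p : ℕ} (h : p ≤ n) (t : UpPairs n p → ℝ) : Matrix (Fin p) (Fin p) ℝ :=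
  Matrix.of fun i j =>
    if hij : i ≤ j then t ⟨(Fin.castLE h i, j), by simpa using hij⟩ else 0

/-- The matrix of the differential of `(x, T) ↦ φ x * T`, where `v` are the partial derivatives
of `φ` and `φ x = U`. -/
def qrJac {n p : ℕ} (U : Matrix (Fin n) (Fin p) ℝ) (v : Pairs n p → Matrix (Fin n) (Fin p) ℝ)
    (T : Matrix (Fin p) (Fin p) ℝ) : Matrix (Fin n × Fin p) (Fin n × Fin p) ℝ :=
  Matrix.of fun a b =>
    if hb : (b.2 : ℕ) < (b.1 : ℕ) then (v ⟨b, hb⟩ * T) a.1 a.2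
    else if a.2 = b.2 then U a.1 ⟨b.1, by omega⟩ else 0

theorem abs_det_eq_one_of_mem_orthogonalGroup {n : ℕ} {V : Matrix (Fin n) (Fin n) ℝ}
    (hV : V ∈ Matrix.orthogonalGroup (Fin n) ℝ) : |V.det| = 1 := by
  have h1 : V * V.transpose = 1 := (Matrix.mem_orthogonalGroup_iff (Fin n) ℝ).mp hV
  have h2 := congrArg Matrix.det h1
  rw [Matrix.det_mul, Matrix.det_one, Matrix.det_transpose] at h2
  exact (abs_eq zero_le_one).mpr (mul_self_eq_one_iff.mp h2)

theorem stiefelForm_apply {n p : ℕ} (V : Matrix (Fin n) (Fin n) ℝ)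
    (v : Pairs n p → Matrix (Fin n) (Fin p) ℝ) :
    stiefelForm p V v = (Matrix.of fun a b : Pairs n p => (V.transpose * v b) a.1.1 a.1.2).det := by
  rw [← Matrix.det_transpose]
  rfl

theorem sum_eq_sum_pairs {n p : ℕ} (i : Fin n) (f : Fin n → Fin p → ℝ)
    (hf : ∀ (k : Fin n) (l : Fin p), k ≠ i ∨ (i : ℕ) ≤ (l : ℕ) → f k l = 0) :
    ∑ l, f i l = ∑ c : Pairs n p, f c.1.1 c.1.2 := by
  rw [← Finset.sum_subtype (p := fun a : Fin n × Fin p => (a.2 : ℕ) < (a.1 : ℕ))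
    (Finset.univ.filter fun a : Fin n × Fin p => (a.2 : ℕ) < (a.1 : ℕ)) (by simp)
    (fun a => f a.1 a.2), Finset.sum_filter, Fintype.sum_prod_type, Finset.sum_eq_single i]
  · refine Finset.sum_congr rfl fun l _ => ?_
    by_cases hl : (l : ℕ) < i
    · simp [hl]
    · simp [hl, hf i l (Or.inr (not_lt.mp hl))]
  · intro k _ hk
    exact Finset.sum_eq_zero fun l _ => by rw [hf k l (Or.inl hk), ite_self]
  · simp

/-- The Jacobian of `(x, T) ↦ φ x * T`. -/
theorem abs_det_qrJac {n p : ℕ} (h : p ≤ n) {U : Matrix (Fin n) (Fin p) ℝ}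
    (hU : U ∈ stiefel n p) (v : Pairs n p → Matrix (Fin n) (Fin p) ℝ)
    {T : Matrix (Fin p) (Fin p) ℝ} (hT : ∀ i j, j < i → T i j = 0) :
    |(qrJac U v T).det| = stiefelDensity h U v * ∏ a : Pairs n p, |T a.1.2 a.1.2| := by
  set V := completion h U
  obtain ⟨hV, hVU⟩ : IsCompletion h U V := completion_spec h hU
  have hVV := (Matrix.mem_orthogonalGroup_iff' (Fin n) ℝ).mp hV
  have hVU' : V.transpose * U = Matrix.of fun i j => if i = Fin.castLE h j then 1 else 0 := by
    ext i j
    have := congrFun (congrFun hVV i) (Fin.castLE h j)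
    rw [Matrix.one_apply] at this
    rw [Matrix.of_apply, ← this, Matrix.mul_apply, Matrix.mul_apply]
    exact Finset.sum_congr rfl fun k _ => by rw [hVU]
  set K : Matrix (Fin n × Fin p) (Fin n × Fin p) ℝ :=
    Matrix.kroneckerMap (· * ·) V.transpose (1 : Matrix (Fin p) (Fin p) ℝ)
  have hK : |K.det| = 1 := by
    rw [Matrix.det_kronecker, Matrix.det_one, one_pow, mul_one, abs_pow,
      Matrix.det_transpose, abs_det_eq_one_of_mem_orthogonalGroup hV, one_pow]
  have hKX : ∀ (X : Matrix (Fin n) (Fin p) ℝ) (a : Fin n × Fin p),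
      ∑ c, K a c * X c.1 c.2 = (V.transpose * X) a.1 a.2 := by
    intro X a
    rw [Fintype.sum_prod_type, Matrix.mul_apply]
    refine Finset.sum_congr rfl fun k _ => ?_
    rw [Finset.sum_eq_single a.2]
    · simp [K, Matrix.kroneckerMap_apply]
    · intro c _ hc
      simp [K, Matrix.kroneckerMap_apply, Matrix.one_apply_ne hc.symm]
    · simp
  set N := K * qrJac U v T
  have hN1 : ∀ a (b : Pairs n p), N a b = (V.transpose * v b * T) a.1 a.2 := by
    intro a b
    rw [Matrix.mul_assoc, ← hKX]
    change (K * qrJac U v T) a b = _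
    rw [Matrix.mul_apply]
    refine Finset.sum_congr rfl fun c _ => ?_
    rw [qrJac, Matrix.of_apply, dif_pos b.2]
  have hN2 : ∀ a (b : UpPairs n p), N a b = if a = b then 1 else 0 := by
    intro a b
    have hb := b.2
    have := hKX (Matrix.of fun k l => if l = b.1.2 then U k ⟨b.1.1, by omega⟩ else 0) a
    trans (V.transpose *
      Matrix.of fun k l => if l = b.1.2 then U k ⟨b.1.1, by omega⟩ else 0) a.1 a.2
    · rw [← this]
      change (K * qrJac U v T) a b = _
      rw [Matrix.mul_apply]
      refine Finset.sum_congr rfl fun c _ => ?_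
      rw [qrJac, Matrix.of_apply, dif_neg b.2, Matrix.of_apply]
    · have h2 := congrFun (congrFun hVU' a.1) ⟨b.1.1, by omega⟩
      rw [Matrix.mul_apply] at h2 ⊢
      by_cases hab : a.2 = b.1.2
      · simp only [Matrix.of_apply, hab, if_true] at h2 ⊢
        rw [h2]
        congr 1
        simp [Prod.ext_iff, hab, Fin.ext_iff]
      · simp [hab, Prod.ext_iff]
  have hdetN : |N.det| = |(qrJac U v T).det| := by
    rw [Matrix.det_mul, abs_mul, hK, one_mul]
  rw [← hdetN, Matrix.twoBlockTriangular_det' N (fun a => (a.2 : ℕ) < (a.1 : ℕ))]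
  swap
  · intro a ha b hb
    rw [hN2 a ⟨b, hb⟩, if_neg]
    rintro rfl
    exact hb ha
  have hone : N.toSquareBlockProp (fun a => ¬ (a.2 : ℕ) < (a.1 : ℕ)) = 1 := by
    ext a b
    rw [Matrix.toSquareBlockProp_def, Matrix.of_apply, hN2 a.1 b, Matrix.one_apply]
    simp [Subtype.ext_iff]
  rw [hone, Matrix.det_one, mul_one]
  let S : Matrix (Pairs n p) (Pairs n p) ℝ :=
    Matrix.of fun a c => if a.1.1 = c.1.1 then T c.1.2 a.1.2 else 0
  have hprod : N.toSquareBlockProp (fun a => (a.2 : ℕ) < (a.1 : ℕ)) =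
      S * Matrix.of fun a b : Pairs n p => (V.transpose * v b) a.1.1 a.1.2 := by
    ext a b
    rw [Matrix.toSquareBlockProp_def, Matrix.of_apply, hN1, Matrix.mul_apply, Matrix.mul_apply]
    have := sum_eq_sum_pairs a.1.1 (fun k l => (if a.1.1 = k then T l a.1.2 else 0) *
      (V.transpose * v b) k l) (by
        intro k l hkl
        rcases hkl with hk | hl
        · simp [hk.symm]
        · have := a.2
          rw [hT l a.1.2 (by rw [Fin.lt_def]; omega)]
          simp)
    simp only [if_true] at this
    simp only [S, Matrix.of_apply]
    rw [← this]
    exact Finset.sum_congr rfl fun _ _ => mul_comm _ _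
  have hS : S.det = ∏ a : Pairs n p, T a.1.2 a.1.2 := by
    let e : Pairs n p → Fin p ×ₗ Fin n := fun a => toLex (a.1.2, a.1.1)
    have he : Function.Injective e := by
      intro a b hab
      have := congrArg ofLex hab
      simp only [e, ofLex_toLex, Prod.mk.injEq] at this
      exact Subtype.ext (Prod.ext this.2 this.1)
    let _ : LinearOrder (Pairs n p) := LinearOrder.lift' e he
    rw [Matrix.det_of_isLowerTriangular]
    · exact Finset.prod_congr rfl fun a _ => by simp [S]
    · intro a b hab
      have hab' : e a < e b := hab
      simp only [S, Matrix.of_apply]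
      split_ifs with h1
      · apply hT
        rcases Prod.Lex.toLex_lt_toLex.mp hab' with h2 | h2
        · exact h2
        · exact absurd h1 h2.2.ne
      · rfl
  rw [hprod, Matrix.det_mul, hS, ← stiefelForm_apply, abs_mul, mul_comm, Finset.abs_prod]
  rfl

/-- The upper triangular matrices with positive diagonal, in coordinates. -/
def posDiag {n p : ℕ} (h : p ≤ n) : Set (UpPairs n p → ℝ) :=
  {t | ∀ j, 0 < upTri h t j j}

theorem upTri_apply_of_lt {n p : ℕ} (h : p ≤ n) (t : UpPairs n p → ℝ) {i j : Fin p} (hij : j < i) :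
    upTri h t i j = 0 := by
  simp [upTri, not_le.mpr hij]

theorem upTri_apply {n p : ℕ} (h : p ≤ n) (t : UpPairs n p → ℝ) (a : UpPairs n p) :
    upTri h t ⟨a.1.1, by have := a.2; omega⟩ a.1.2 = t a := by
  have := a.2
  have h1 : (⟨a.1.1, by omega⟩ : Fin p) ≤ a.1.2 := by
    rw [Fin.le_def]
    exact not_lt.mp this
  rw [upTri, Matrix.of_apply, dif_pos h1]
  rfl

theorem upTri_injective {n p : ℕ} (h : p ≤ n) : Function.Injective (upTri (n := n) h) := by
  intro t t' htt
  ext a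
  rw [← upTri_apply h t a, htt, upTri_apply]

theorem eq_one_of_upper_of_orthogonal {p : ℕ} {S : Matrix (Fin p) (Fin p) ℝ}
    (hS : S.BlockTriangular id) (hpos : ∀ j, 0 < S j j) (hSS : S.transpose * S = 1) : S = 1 := by
  let _ : Invertible S :=
    Matrix.invertibleOfIsUnitDet S (Matrix.isUnit_det_of_left_inverse hSS)
  have hinv : S⁻¹ = S.transpose := Matrix.inv_eq_left_inv hSS
  have hlow : (S⁻¹).BlockTriangular id := Matrix.blockTriangular_inv_of_blockTriangular hS
  have hoff : ∀ i j, i ≠ j → S i j = 0 := by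
    intro i j hij
    rcases lt_or_gt_of_ne hij with h1 | h1
    · have := hlow (i := j) (j := i) h1
      rwa [hinv] at this
    · exact hS h1
  ext i j
  by_cases hij : i = j
  · subst hij
    have := congrFun (congrFun hSS i) i
    rw [Matrix.mul_apply, Finset.sum_eq_single i] at this
    · simp only [Matrix.transpose_apply, Matrix.one_apply_eq] at this ⊢
      nlinarith [hpos i]
    · intro k _ hk
      simp [hoff k i hk]
    · simp
  · rw [hoff i j hij, Matrix.one_apply_ne hij]

/-- Uniqueness of the `QR` decomposition. -/
theorem qr_unique {n p : ℕ} {U U' : Matrix (Fin n) (Fin p) ℝ}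
    (hU : U ∈ stiefel n p) (hU' : U' ∈ stiefel n p) {T T' : Matrix (Fin p) (Fin p) ℝ}
    (hT : T.BlockTriangular id) (hT' : T'.BlockTriangular id)
    (hp : ∀ j, 0 < T j j) (hp' : ∀ j, 0 < T' j j) (heq : U * T = U' * T') : U = U' ∧ T = T' := by
  have hU1 : U.transpose * U = 1 := hU
  have hU1' : U'.transpose * U' = 1 := hU'
  have hdet' : T'.det ≠ 0 := by
    rw [Matrix.det_of_isUpperTriangular hT']
    exact Finset.prod_ne_zero_iff.mpr fun j _ => (hp' j).ne'
  have hunit : IsUnit T'.det := isUnit_iff_ne_zero.mpr hdet'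
  let _ : Invertible T' := Matrix.invertibleOfIsUnitDet T' hunit
  have hinv := Matrix.blockTriangular_inv_of_blockTriangular hT'
  have hSdiag : ∀ (A B : Matrix (Fin p) (Fin p) ℝ), A.BlockTriangular id → B.BlockTriangular id →
      ∀ j, (A * B) j j = A j j * B j j := by
    intro A B hA hB j
    rw [Matrix.mul_apply, Finset.sum_eq_single j]
    · intro k _ hk
      rcases lt_or_gt_of_ne hk with h1 | h1
      · rw [hA h1, zero_mul]
      · rw [hB h1, mul_zero]
    · simp
  have hinvpos : ∀ j, 0 < (T'⁻¹) j j := by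
    intro j
    have h1 := hSdiag T' T'⁻¹ hT' hinv j
    rw [Matrix.mul_nonsing_inv T' hunit, Matrix.one_apply_eq] at h1
    exact pos_of_mul_pos_right (h1 ▸ one_pos) (hp' j).le
  have hUS : U * (T * T'⁻¹) = U' := by
    rw [← Matrix.mul_assoc, heq, Matrix.mul_assoc, Matrix.mul_nonsing_inv T' hunit, Matrix.mul_one]
  have hS1 : T * T'⁻¹ = 1 := by
    apply eq_one_of_upper_of_orthogonal (hT.mul hinv)
    · intro j
      rw [hSdiag T T'⁻¹ hT hinv]
      exact mul_pos (hp j) (hinvpos j)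
    · rw [← hUS, Matrix.transpose_mul, Matrix.mul_assoc, ← Matrix.mul_assoc U.transpose, hU1,
        Matrix.one_mul] at hU1'
      exact hU1'
  refine ⟨by rw [← hUS, hS1, Matrix.mul_one], ?_⟩
  have := congrArg (· * T') hS1
  simpa only [Matrix.mul_assoc, Matrix.nonsing_inv_mul T' hunit, Matrix.mul_one,
    Matrix.one_mul] using this

theorem upTri_blockTriangular {n p : ℕ} (h : p ≤ n) (t : UpPairs n p → ℝ) :
    (upTri h t).BlockTriangular id := fun _ _ hij => upTri_apply_of_lt h t hij

/-- The product `U * T`, as a vector of entries. -/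
def qrProd {n p : ℕ} (h : p ≤ n) (U : Matrix (Fin n) (Fin p) ℝ) (t : UpPairs n p → ℝ) :
    Fin n × Fin p → ℝ :=
  fun a => (U * upTri h t) a.1 a.2

theorem qrProd_injOn {n p : ℕ} (h : p ≤ n) {U U' : Matrix (Fin n) (Fin p) ℝ}
    {t t' : UpPairs n p → ℝ} (hU : U ∈ stiefel n p) (hU' : U' ∈ stiefel n p)
    (ht : t ∈ posDiag h) (ht' : t' ∈ posDiag h) (heq : qrProd h U t = qrProd h U' t') :
    U = U' ∧ t = t' := by
  have h1 : U * upTri h t = U' * upTri h t' := by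
    ext i j
    exact congrFun heq (i, j)
  obtain ⟨h2, h3⟩ := qr_unique hU hU' (upTri_blockTriangular h t) (upTri_blockTriangular h t')
    ht ht' h1
  exact ⟨h2, upTri_injective h h3⟩

theorem sum_sq_eq_trace {n p : ℕ} (X : Matrix (Fin n) (Fin p) ℝ) :
    ∑ a : Fin n × Fin p, (X a.1 a.2) ^ 2 = (X.transpose * X).trace := by
  rw [Fintype.sum_prod_type, Finset.sum_comm, Matrix.trace]
  refine Finset.sum_congr rfl fun j _ => ?_
  rw [Matrix.diag_apply, Matrix.mul_apply]
  exact Finset.sum_congr rfl fun i _ => by rw [Matrix.transpose_apply, sq]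

@[to_additive]
theorem prod_upPairs {n p : ℕ} {M : Type*} [CommMonoid M] (h : p ≤ n) (f : Fin p → Fin p → M)
    (hf : ∀ i j, j < i → f i j = 1) :
    ∏ a : UpPairs n p, f ⟨a.1.1, by have := a.2; omega⟩ a.1.2 =
      ∏ a : Fin p × Fin p, f a.1 a.2 := by
  refine Finset.prod_of_injOn
    (fun a : UpPairs n p => ((⟨a.1.1, by have := a.2; omega⟩, a.1.2) : Fin p × Fin p)) ?_
    (fun _ _ => Finset.mem_coe.mpr (Finset.mem_univ _)) ?_ fun _ _ => rfl
  · intro a _ b _ hab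
    simp only [Prod.mk.injEq, Fin.mk.injEq] at hab
    exact Subtype.ext (Prod.ext (Fin.ext hab.1) hab.2)
  · intro c _ hc
    refine hf _ _ (not_le.mp fun hle => hc ⟨⟨(Fin.castLE h c.1, c.2), ?_⟩, by simp, rfl⟩)
    simpa using hle

theorem sum_qrProd_sq {n p : ℕ} (h : p ≤ n) {U : Matrix (Fin n) (Fin p) ℝ}
    (hU : U ∈ stiefel n p) (t : UpPairs n p → ℝ) :
    ∑ a, (qrProd h U t a) ^ 2 = ∑ a, (t a) ^ 2 := by
  have hU1 : U.transpose * U = 1 := hU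
  have h1 := sum_upPairs (n := n) h (fun i j => (upTri h t i j) ^ 2)
    fun i j hij => by simp [upTri_apply_of_lt h t hij]
  simp only [upTri_apply] at h1
  rw [h1, sum_sq_eq_trace]
  simp only [qrProd]
  rw [sum_sq_eq_trace, Matrix.transpose_mul, Matrix.mul_assoc, ← Matrix.mul_assoc U.transpose, hU1,
    Matrix.one_mul]

/-- The strictly lower entries. -/
def lowPart {n p : ℕ} (y : Fin n × Fin p → ℝ) : Pairs n p → ℝ := fun a => y a

/-- The upper entries. -/
def upPart {n p : ℕ} (y : Fin n × Fin p → ℝ) : UpPairs n p → ℝ := fun a => y a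

/-- `lowPart` as a continuous linear map. -/
def lowPartCLM (n p : ℕ) : (Fin n × Fin p → ℝ) →L[ℝ] (Pairs n p → ℝ) :=
  ContinuousLinearMap.pi fun a => ContinuousLinearMap.proj (a : Fin n × Fin p)

/-- The coordinates of the upper triangular matrix given by the upper entries. -/
def upTriCLM {n p : ℕ} (h : p ≤ n) (i j : Fin p) : (Fin n × Fin p → ℝ) →L[ℝ] ℝ :=
  if i ≤ j then ContinuousLinearMap.proj (Fin.castLE h i, j) else 0

theorem upTriCLM_apply {n p : ℕ} (h : p ≤ n) (i j : Fin p) (y : Fin n × Fin p → ℝ) :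
    upTriCLM h i j y = upTri h (upPart y) i j := by
  by_cases hij : i ≤ j <;> simp [upTriCLM, upTri, upPart, hij]

/-- The parametrization `(x, T) ↦ φ x * T`. -/
def qrMap {n p : ℕ} (h : p ≤ n) (φ : (Pairs n p → ℝ) → Matrix (Fin n) (Fin p) ℝ)
    (y : Fin n × Fin p → ℝ) : Fin n × Fin p → ℝ :=
  qrProd h (φ (lowPart y)) (upPart y)

/-- The differential of `qrMap`. -/
def qrDeriv {n p : ℕ} (h : p ≤ n) (φ : (Pairs n p → ℝ) → Matrix (Fin n) (Fin p) ℝ)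
    (y : Fin n × Fin p → ℝ) : (Fin n × Fin p → ℝ) →L[ℝ] (Fin n × Fin p → ℝ) :=
  LinearMap.toContinuousLinearMap (Matrix.toLin' (qrJac (φ (lowPart y))
    (fun b => fderiv ℝ φ (lowPart y) (Pi.single b 1)) (upTri h (upPart y))))

theorem qrDeriv_det {n p : ℕ} (h : p ≤ n) (φ : (Pairs n p → ℝ) → Matrix (Fin n) (Fin p) ℝ)
    (y : Fin n × Fin p → ℝ) (hU : φ (lowPart y) ∈ stiefel n p) :
    |(qrDeriv h φ y).det| = stiefelDensity h (φ (lowPart y))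
      (fun b => fderiv ℝ φ (lowPart y) (Pi.single b 1)) *
        ∏ a : Pairs n p, |upTri h (upPart y) a.1.2 a.1.2| := by
  rw [← abs_det_qrJac h hU _ fun i j hij => upTri_apply_of_lt h _ hij, ← LinearMap.det_toLin']
  rfl

theorem hasFDerivAt_entry {E : Type*} [NormedAddCommGroup E] [NormedSpace ℝ E] {n p : ℕ}
    {φ : E → Matrix (Fin n) (Fin p) ℝ} {φ' : E →L[ℝ] Matrix (Fin n) (Fin p) ℝ} {x : E}
    (hφ : HasFDerivAt φ φ' x) (k : Fin n) (l : Fin p) :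
    HasFDerivAt (fun x => φ x k l)
      ((LinearMap.toContinuousLinearMap (Matrix.entryLinearMap ℝ ℝ k l)).comp φ') x :=
  (LinearMap.toContinuousLinearMap (Matrix.entryLinearMap ℝ ℝ k l)).hasFDerivAt.comp x hφ

theorem hasFDerivAt_qrMap {n p : ℕ} (h : p ≤ n) {φ : (Pairs n p → ℝ) → Matrix (Fin n) (Fin p) ℝ}
    {y : Fin n × Fin p → ℝ} (hφ : DifferentiableAt ℝ φ (lowPart y)) :
    HasFDerivAt (qrMap h φ) (qrDeriv h φ y) y := by
  rw [hasFDerivAt_pi']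
  intro a
  have h1 : HasFDerivAt (fun y => ∑ l, φ (lowPart y) a.1 l * upTriCLM h l a.2 y)
      (∑ l, (φ (lowPart y) a.1 l • upTriCLM h l a.2 + upTriCLM h l a.2 y •
        ((LinearMap.toContinuousLinearMap (Matrix.entryLinearMap ℝ ℝ a.1 l)).comp
          (fderiv ℝ φ (lowPart y))).comp (lowPartCLM n p))) y := by
    refine HasFDerivAt.fun_sum fun l _ => HasFDerivAt.mul ?_ (upTriCLM h l a.2).hasFDerivAt
    exact HasFDerivAt.comp y (f := lowPartCLM n p) (g := fun x => φ x a.1 l)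
      (hasFDerivAt_entry hφ.hasFDerivAt a.1 l) (lowPartCLM n p).hasFDerivAt
  have h2 : (fun y => qrMap h φ y a) = fun y => ∑ l, φ (lowPart y) a.1 l * upTriCLM h l a.2 y := by
    ext y
    simp only [qrMap, qrProd, Matrix.mul_apply, upTriCLM_apply]
  rw [h2]
  refine h1.congr_fderiv ?_
  apply ContinuousLinearMap.coe_injective
  refine LinearMap.pi_ext' fun b => LinearMap.ext_ring ?_
  have hlow : lowPartCLM n p (Pi.single b 1) =
      if hb : (b.2 : ℕ) < (b.1 : ℕ) then Pi.single ⟨b, hb⟩ 1 else 0 := by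
    ext c
    split_ifs with hb
    · simp [lowPartCLM, Pi.single_apply, Subtype.ext_iff]
    · have : (c : Fin n × Fin p) ≠ b := fun hc => hb (hc ▸ c.2)
      simp [lowPartCLM, this]
  have hup : ∀ l, upTriCLM h l a.2 (Pi.single b 1) =
      if b = (Fin.castLE h l, a.2) ∧ l ≤ a.2 then 1 else 0 := by
    intro l
    by_cases hl : l ≤ a.2 <;> simp [upTriCLM, hl, Pi.single_apply, eq_comm]
  trans qrJac (φ (lowPart y)) (fun b => fderiv ℝ φ (lowPart y) (Pi.single b 1))
    (upTri h (upPart y)) a b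
  · by_cases hb : (b.2 : ℕ) < (b.1 : ℕ)
    · have hne : ∀ l, ¬ (b = (Fin.castLE h l, a.2) ∧ l ≤ a.2) := by
        rintro l ⟨rfl, hl⟩
        exact absurd hb (not_lt.mpr hl)
      simp [hlow, hup, qrJac, hb, hne, Matrix.mul_apply, upTriCLM_apply, mul_comm]
    · simp only [hlow, hup, qrJac, hb, dif_neg, not_false_eq_true, Matrix.of_apply, mul_ite,
        ContinuousLinearMap.coe_coe, sum_apply, add_apply,
        smul_apply, ContinuousLinearMap.comp_apply, map_zero,
        add_zero, smul_eq_mul, mul_one, mul_zero, LinearMap.coe_comp, Function.comp_apply,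
        LinearMap.single_apply]
      rw [Finset.sum_eq_single ⟨b.1, by omega⟩]
      · refine if_congr ?_ rfl rfl
        rw [Fin.le_def, Prod.ext_iff]
        constructor
        · exact fun h1 => h1.1.2.symm
        · exact fun h1 => ⟨⟨rfl, h1.symm⟩, h1 ▸ not_lt.mp hb⟩
      · intro l _ hl
        rw [if_neg]
        rintro ⟨rfl, -⟩
        exact hl rfl
      · simp
  · simp [qrDeriv]

theorem continuousOn_qrJac {X : Type*} [TopologicalSpace X] {s : Set X} {n p : ℕ}
    {U : X → Matrix (Fin n) (Fin p) ℝ} {v : X → Pairs n p → Matrix (Fin n) (Fin p) ℝ}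
    (T : Matrix (Fin p) (Fin p) ℝ)
    (hU : ∀ k l, ContinuousOn (fun x => U x k l) s)
    (hv : ∀ b k l, ContinuousOn (fun x => v x b k l) s) :
    ContinuousOn (fun x => (qrJac (U x) (v x) T).det) s := by
  refine Continuous.comp_continuousOn (g := Matrix.det)
    (Continuous.matrix_det continuous_id) ?_
  refine continuousOn_pi.2 fun a => continuousOn_pi.2 fun b => ?_
  simp only [qrJac, Matrix.of_apply]
  split_ifs with h1 h2
  · simp only [Matrix.mul_apply]
    exact continuousOn_finsetSum _ fun l _ => (hv _ _ _).mul continuousOn_const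
  · exact hU _ _
  · exact continuousOn_const

theorem continuousOn_stiefelDensity {n p : ℕ} (h : p ≤ n) {Ω : Set (Pairs n p → ℝ)}
    {φ : (Pairs n p → ℝ) → Matrix (Fin n) (Fin p) ℝ} (hφ : IsParam (stiefel n p) Ω φ) :
    ContinuousOn (fun x => stiefelDensity h (φ x) fun a => fderiv ℝ φ x (Pi.single a 1)) Ω := by
  have hc : ContinuousOn (fun x => |(qrJac (φ x) (fun a => fderiv ℝ φ x (Pi.single a 1)) 1).det|)
      Ω := by
    refine ContinuousOn.abs (continuousOn_qrJac _ (fun k l => ?_) fun b k l => ?_)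
    · exact continuousOn_pi.1 (continuousOn_pi.1 hφ.contDiffOn.continuousOn k) l
    · have h1 := hφ.contDiffOn.continuousOn_fderiv_of_isOpen hφ.isOpen le_rfl
      have h2 : ContinuousOn (fun x => fderiv ℝ φ x (Pi.single b 1)) Ω :=
        h1.clm_apply continuousOn_const
      exact continuousOn_pi.1 (continuousOn_pi.1 h2 k) l
  refine hc.congr fun x hx => ?_
  have h1 := abs_det_qrJac h (hφ.mapsTo hx) (fun a => fderiv ℝ φ x (Pi.single a 1)) (T := 1)
    fun i j hij => Matrix.one_apply_ne hij.ne'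
  simp only [Matrix.one_apply_eq, abs_one, Finset.prod_const_one, mul_one] at h1
  exact h1.symm

/-- The matrices that have a `QR` decomposition with positive diagonal. -/
def qrDomain {n p : ℕ} (h : p ≤ n) : Set (Fin n × Fin p → ℝ) :=
  {X | ∃ U ∈ stiefel n p, ∃ t ∈ posDiag h, qrProd h U t = X}

/-- The orthonormal factor in the `QR` decomposition. -/
def qrFactor {n p : ℕ} (h : p ≤ n) (X : Fin n × Fin p → ℝ) : Matrix (Fin n) (Fin p) ℝ :=
  open Classical in if hX : X ∈ qrDomain h then hX.choose else 0

theorem qrFactor_qrProd {n p : ℕ} (h : p ≤ n) {U : Matrix (Fin n) (Fin p) ℝ}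
    {t : UpPairs n p → ℝ} (hU : U ∈ stiefel n p) (ht : t ∈ posDiag h) :
    qrFactor h (qrProd h U t) = U := by
  have hX : qrProd h U t ∈ qrDomain h := ⟨U, hU, t, ht, rfl⟩
  rw [qrFactor, dif_pos hX]
  obtain ⟨hU', t', ht', heq⟩ := hX.choose_spec
  exact (qrProd_injOn h hU' hU ht' ht heq).1

theorem continuous_upTri {n p : ℕ} (h : p ≤ n) (i j : Fin p) :
    Continuous fun t : UpPairs n p → ℝ => upTri h t i j := by
  by_cases hij : i ≤ j
  · simp only [upTri, Matrix.of_apply, hij, dif_pos]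
    exact continuous_apply _
  · simp only [upTri, Matrix.of_apply, hij, dif_neg, not_false_eq_true]
    exact continuous_const

theorem isOpen_posDiag {n p : ℕ} (h : p ≤ n) : IsOpen (posDiag (n := n) h) := by
  simp only [posDiag, Set.ofPred_forall]
  exact isOpen_iInter_of_finite fun j => isOpen_lt continuous_const (continuous_upTri h j j)

theorem isClosed_stiefel (n p : ℕ) : IsClosed (stiefel n p) :=
  isClosed_eq (continuous_id.matrix_transpose.matrix_mul continuous_id) continuous_const

theorem measurableSet_stiefel (n p : ℕ) : MeasurableSet (stiefel n p) :=
  (isClosed_stiefel n p).measurableSet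

theorem measurableSet_qrProd_image {n p : ℕ} (h : p ≤ n) {A : Set (Matrix (Fin n) (Fin p) ℝ)}
    (hA : MeasurableSet A) :
    MeasurableSet {X | ∃ U ∈ A ∩ stiefel n p, ∃ t ∈ posDiag h, qrProd h U t = X} := by
  let f : (Fin n → Fin p → ℝ) × (UpPairs n p → ℝ) → (Fin n × Fin p → ℝ) :=
    fun z => qrProd h (Matrix.of z.1) z.2
  have hf : Continuous f := by
    refine continuous_pi fun a => ?_
    simp only [f, qrProd, Matrix.mul_apply]
    refine continuous_finsetSum _ fun l _ => Continuous.mul ?_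
      ((continuous_upTri h _ _).comp continuous_snd)
    exact (continuous_apply l).comp ((continuous_apply a.1).comp continuous_fst)
  have hs : MeasurableSet ((A ∩ stiefel n p : Set (Fin n → Fin p → ℝ)) ×ˢ posDiag (n := n) h) :=
    MeasurableSet.prod (hA.inter (measurableSet_stiefel n p)) (isOpen_posDiag h).measurableSet
  have hinj : Set.InjOn f ((A ∩ stiefel n p : Set (Fin n → Fin p → ℝ)) ×ˢ posDiag (n := n) h) := by
    rintro ⟨U, t⟩ ⟨hU, ht⟩ ⟨U', t'⟩ ⟨hU', ht'⟩ heq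
    obtain ⟨h1, h2⟩ := qrProd_injOn h hU.2 hU'.2 ht ht' heq
    exact Prod.ext h1 h2
  have := hs.image_of_continuousOn_injOn hf.continuousOn hinj
  convert this using 1
  ext X
  constructor
  · rintro ⟨U, hU, t, ht, rfl⟩
    exact ⟨(U, t), ⟨hU, ht⟩, rfl⟩
  · rintro ⟨⟨U, t⟩, ⟨hU, ht⟩, rfl⟩
    exact ⟨U, hU, t, ht, rfl⟩

theorem measurableSet_qrDomain {n p : ℕ} (h : p ≤ n) : MeasurableSet (qrDomain (n := n) h) := by
  have := measurableSet_qrProd_image (n := n) h MeasurableSet.univ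
  rwa [Set.univ_inter] at this

theorem measurable_qrFactor {n p : ℕ} (h : p ≤ n) : Measurable (qrFactor (n := n) h) := by
  refine measurable_of_restrict_of_restrict_compl (measurableSet_qrDomain h) ?_ ?_
  · intro A hA
    refine ⟨_, measurableSet_qrProd_image h hA, ?_⟩
    ext ⟨X, hX⟩
    obtain ⟨U, hU, t, ht, rfl⟩ := hX
    simp only [Set.mem_preimage, Set.domRestrict_apply, qrFactor_qrProd h hU ht]
    constructor
    · rintro ⟨U', hU', t', ht', heq⟩
      rw [← (qrProd_injOn h hU'.2 hU ht' ht heq).1]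
      exact hU'.1
    · exact fun hUA => ⟨U, ⟨hUA, hU⟩, t, ht, rfl⟩
  · have : (qrDomain h)ᶜ.domRestrict (qrFactor h) = fun _ => (0 : Matrix (Fin n) (Fin p) ℝ) := by
      ext1 X
      exact dif_neg X.2
    rw [this]
    exact measurable_const

/-- The weight `exp (-∑ yᵢ²)`. -/
def gaussWeight {ι : Type*} [Fintype ι] (y : ι → ℝ) : ENNReal :=
  ENNReal.ofReal (Real.exp (-∑ i, (y i) ^ 2))

theorem continuous_gaussWeight {ι : Type*} [Fintype ι] :
    Continuous (gaussWeight : (ι → ℝ) → ENNReal) := by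
  exact ENNReal.continuous_ofReal.comp (by fun_prop)

/-- The measure `exp (-∑ yᵢ²) dy`. -/
def gaussMeasure (ι : Type*) [Fintype ι] : Measure (ι → ℝ) :=
  volume.withDensity gaussWeight

/-- The integral over the triangular factor in the `QR` decomposition. -/
def qrConst {n p : ℕ} (h : p ≤ n) : ENNReal :=
  ∫⁻ t in posDiag (n := n) h,
    ENNReal.ofReal (∏ a : Pairs n p, |upTri h t a.1.2 a.1.2|) * gaussWeight t

theorem measurable_prod_upTri {n p : ℕ} (h : p ≤ n) : Measurable fun t : UpPairs n p → ℝ =>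
    ENNReal.ofReal (∏ a : Pairs n p, |upTri h t a.1.2 a.1.2|) * gaussWeight t := by
  refine Measurable.mul ?_ continuous_gaussWeight.measurable
  refine ENNReal.measurable_ofReal.comp ?_
  exact (continuous_finsetProd _ fun a _ => (continuous_upTri h _ _).abs).measurable

theorem setLIntegral_lowPart_upPart {n p : ℕ} {B : Set (Pairs n p → ℝ)}
    {P : Set (UpPairs n p → ℝ)} {f : (Pairs n p → ℝ) → ENNReal}
    {g : (UpPairs n p → ℝ) → ENNReal} (hf : AEMeasurable f (volume.restrict B))
    (hg : AEMeasurable g (volume.restrict P)) :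
    ∫⁻ y : Fin n × Fin p → ℝ in {y | lowPart y ∈ B ∧ upPart y ∈ P}, f (lowPart y) * g (upPart y) =
      (∫⁻ x in B, f x) * ∫⁻ t in P, g t := by
  let e := MeasurableEquiv.piEquivPiSubtypeProd (fun _ : Fin n × Fin p => ℝ)
    (fun a => (a.2 : ℕ) < (a.1 : ℕ))
  have he : MeasurePreserving e volume volume := volume_preserving_piEquivPiSubtypeProd _ _
  have h1 := he.setLIntegral_comp_preimage_emb e.measurableEmbedding
    (fun z => f z.1 * g z.2) (B ×ˢ P)
  rw [← lintegral_prod_mul hf hg, Measure.prod_restrict, ← Measure.volume_eq_prod]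
  exact h1

theorem IsParam.measurableSet_inter_preimage {n p : ℕ} {Ω : Set (Pairs n p → ℝ)}
    {φ : (Pairs n p → ℝ) → Matrix (Fin n) (Fin p) ℝ} (hφ : IsParam (stiefel n p) Ω φ)
    {A : Set (Matrix (Fin n) (Fin p) ℝ)} (hA : MeasurableSet A) : MeasurableSet (φ ⁻¹' A ∩ Ω) := by
  classical
  have h1 : Measurable (Ω.piecewise φ fun _ => 0) :=
    hφ.contDiffOn.continuousOn.measurable_piecewise continuousOn_const hφ.isOpen.measurableSet
  have h2 : φ ⁻¹' A ∩ Ω = (Ω.piecewise φ fun _ => 0) ⁻¹' A ∩ Ω := by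
    ext x
    refine and_congr_left fun hx => ?_
    rw [Set.mem_preimage, Set.mem_preimage, Set.piecewise_eq_of_mem _ _ _ hx]
  rw [h2]
  exact (h1 hA).inter hφ.isOpen.measurableSet

theorem paramMeasure_apply {n p : ℕ} (h : p ≤ n) {Ω : Set (Pairs n p → ℝ)}
    {φ : (Pairs n p → ℝ) → Matrix (Fin n) (Fin p) ℝ} (hφ : IsParam (stiefel n p) Ω φ)
    {A : Set (Matrix (Fin n) (Fin p) ℝ)} (hA : MeasurableSet A) :
    paramMeasure (stiefelDensity h) Ω φ A = ∫⁻ x in φ ⁻¹' A ∩ Ω,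
      ENNReal.ofReal (stiefelDensity h (φ x) fun a => fderiv ℝ φ x (Pi.single a 1)) := by
  have hm : AEMeasurable φ (volume.restrict Ω) :=
    hφ.contDiffOn.continuousOn.aemeasurable hφ.isOpen.measurableSet
  rw [paramMeasure, Measure.map_apply_of_aemeasurable
    (hm.mono_ac (withDensity_absolutelyContinuous _ _)) hA, withDensity_apply',
    Measure.restrict_restrict' hφ.isOpen.measurableSet]
  rfl

theorem stiefelDensity_nonneg {n p : ℕ} (h : p ≤ n) (U : Matrix (Fin n) (Fin p) ℝ)
    (v : Pairs n p → Matrix (Fin n) (Fin p) ℝ) : 0 ≤ stiefelDensity h U v :=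
  abs_nonneg _

/-- Change of variables in the `QR` decomposition. -/
theorem gaussMeasure_qrProd_image {n p : ℕ} (h : p ≤ n) {Ω : Set (Pairs n p → ℝ)}
    {φ : (Pairs n p → ℝ) → Matrix (Fin n) (Fin p) ℝ} (hφ : IsParam (stiefel n p) Ω φ)
    {A : Set (Matrix (Fin n) (Fin p) ℝ)} (hA : MeasurableSet A) :
    gaussMeasure (Fin n × Fin p) {X | ∃ U ∈ A ∩ φ '' Ω, ∃ t ∈ posDiag h, qrProd h U t = X} =
      qrConst h * paramMeasure (stiefelDensity h) Ω φ A := by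
  have hB := hφ.measurableSet_inter_preimage hA
  set B := φ ⁻¹' A ∩ Ω with hBdef
  have hP := (isOpen_posDiag (n := n) h).measurableSet
  set D : Set (Fin n × Fin p → ℝ) := {y | lowPart y ∈ B ∧ upPart y ∈ posDiag h} with hD
  have hDm : MeasurableSet D := by
    refine MeasurableSet.inter (measurableSet_preimage ?_ hB) (measurableSet_preimage ?_ hP)
    · exact measurable_pi_lambda _ fun a => measurable_pi_apply _
    · exact measurable_pi_lambda _ fun a => measurable_pi_apply _
  have himage : {X | ∃ U ∈ A ∩ φ '' Ω, ∃ t ∈ posDiag h, qrProd h U t = X} = qrMap h φ '' D := by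
    ext X
    constructor
    · rintro ⟨_, ⟨hUA, x, hx, rfl⟩, t, ht, rfl⟩
      let y : Fin n × Fin p → ℝ := fun a =>
        if ha : (a.2 : ℕ) < (a.1 : ℕ) then x ⟨a, ha⟩ else t ⟨a, ha⟩
      have h1 : lowPart y = x := by
        ext a
        exact dif_pos a.2
      have h2 : upPart y = t := by
        ext a
        exact dif_neg a.2
      refine ⟨y, ⟨?_, ?_⟩, ?_⟩
      · rw [h1]
        exact ⟨hUA, hx⟩
      · rwa [h2]
      · rw [qrMap, h1, h2]
    · rintro ⟨y, ⟨⟨h1, h2⟩, h3⟩, rfl⟩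
      exact ⟨φ (lowPart y), ⟨h1, _, h2, rfl⟩, upPart y, h3, rfl⟩
  have hinj : Set.InjOn (qrMap h φ) D := by
    rintro y ⟨⟨_, h2⟩, h3⟩ y' ⟨⟨_, h2'⟩, h3'⟩ heq
    obtain ⟨h4, h5⟩ := qrProd_injOn h (hφ.mapsTo h2) (hφ.mapsTo h2') h3 h3' heq
    have h6 := hφ.injOn h2 h2' h4
    ext a
    by_cases ha : (a.2 : ℕ) < (a.1 : ℕ)
    · exact congrFun h6 ⟨a, ha⟩
    · exact congrFun h5 ⟨a, ha⟩
  have hder : ∀ y ∈ D, HasFDerivWithinAt (qrMap h φ) (qrDeriv h φ y) D y := fun y hy =>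
    (hasFDerivAt_qrMap h ((hφ.contDiffOn.differentiableOn one_ne_zero _ hy.1.2).differentiableAt
      (hφ.isOpen.mem_nhds hy.1.2))).hasFDerivWithinAt
  rw [himage, gaussMeasure, withDensity_apply', lintegral_image_eq_lintegral_abs_det_fderiv_mul
    volume hDm hder hinj, paramMeasure_apply h hφ hA, mul_comm, qrConst,
    ← setLIntegral_lowPart_upPart _ (measurable_prod_upTri h).aemeasurable]
  · refine setLIntegral_congr_fun hDm fun y hy => ?_
    rw [qrDeriv_det h φ y (hφ.mapsTo hy.1.2), ENNReal.ofReal_mul (stiefelDensity_nonneg h _ _), mul_assoc]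
    congr 2
    rw [gaussWeight, qrMap, sum_qrProd_sq h (hφ.mapsTo hy.1.2)]
    rfl
  · refine ENNReal.measurable_ofReal.comp_aemeasurable ?_
    exact ((continuousOn_stiefelDensity h hφ).mono Set.inter_subset_right).aemeasurable hB

theorem lintegral_ofReal_prod {ι : Type*} [Fintype ι] {f : ι → ℝ → ℝ}
    (hf : ∀ i, Integrable (f i)) (h0 : ∀ i s, 0 ≤ f i s) :
    ∫⁻ y : ι → ℝ, ENNReal.ofReal (∏ i, f i (y i)) = ENNReal.ofReal (∏ i, ∫ s, f i s) := by
  rw [← ofReal_integral_eq_lintegral_ofReal, integral_fintype_prod_volume_eq_prod]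
  · exact Integrable.fintype_prod hf
  · exact Filter.Eventually.of_forall fun y => Finset.prod_nonneg fun i _ => h0 i _

theorem integrable_exp_neg_sq : Integrable fun s : ℝ => Real.exp (-s ^ 2) := by
  simpa using integrable_exp_neg_mul_sq one_pos

theorem integral_exp_neg_sq : ∫ s : ℝ, Real.exp (-s ^ 2) = √Real.pi := by
  simpa using integral_gaussian 1

theorem integral_Ioi_pow_mul_exp_neg_sq (m : ℕ) :
    ∫ s in Set.Ioi (0 : ℝ), s ^ m * Real.exp (-s ^ 2) = Real.Gamma (((m : ℝ) + 1) / 2) / 2 := by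
  have h1 := integral_rpow_mul_exp_neg_rpow (p := 2) (q := m) two_pos
    (by have := m.cast_nonneg (α := ℝ); linarith)
  simp only [Real.rpow_natCast, Real.rpow_two] at h1
  rw [h1]
  ring

theorem integrableOn_Ioi_pow_mul_exp_neg_sq (m : ℕ) :
    IntegrableOn (fun s : ℝ => s ^ m * Real.exp (-s ^ 2)) (Set.Ioi 0) := by
  have h1 := integrableOn_rpow_mul_exp_neg_rpow (p := 2) (s := m)
    (by have := m.cast_nonneg (α := ℝ); linarith) two_pos
  simpa only [Real.rpow_natCast, Real.rpow_two] using h1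

theorem gaussMeasure_univ (ι : Type*) [Fintype ι] :
    gaussMeasure ι Set.univ = ENNReal.ofReal (√Real.pi ^ Fintype.card ι) := by
  rw [gaussMeasure, withDensity_apply _ MeasurableSet.univ, Measure.restrict_univ]
  have h1 := lintegral_ofReal_prod (ι := ι) (f := fun _ s => Real.exp (-s ^ 2))
    (fun _ => integrable_exp_neg_sq) fun _ s => (Real.exp_pos _).le
  rw [integral_exp_neg_sq, Finset.prod_const, Finset.card_univ] at h1
  rw [← h1]
  refine lintegral_congr fun y => ?_
  rw [gaussWeight, ← Real.exp_sum, Finset.sum_neg_distrib]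

theorem prod_pairs {n p : ℕ} (h : p ≤ n) (g : Fin p → ℝ) :
    ∏ a : Pairs n p, g a.1.2 = ∏ j, g j ^ (n - 1 - j) := by
  rw [← Finset.prod_subtype (p := fun a : Fin n × Fin p => (a.2 : ℕ) < (a.1 : ℕ))
    (Finset.univ.filter fun a : Fin n × Fin p => (a.2 : ℕ) < (a.1 : ℕ)) (by simp)
    (fun a => g a.2), Finset.prod_filter, Fintype.prod_prod_type_right]
  refine Finset.prod_congr rfl fun j _ => ?_
  simp only
  rw [← Finset.prod_filter, Finset.prod_const]
  congr 1
  have := Fin.card_Ioi (Fin.castLE h j)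
  rw [Fin.val_castLE] at this
  rw [← this]
  congr 1
  ext i
  simp [Fin.lt_def]

/-- A product over the upper entries in which off-diagonal entries contribute `s`. -/
theorem prod_upPairs_diag {n p : ℕ} (h : p ≤ n) (c : Fin p → ℝ) (s : ℝ) :
    ∏ a : UpPairs n p, (if (a.1.1 : ℕ) = a.1.2 then c a.1.2 else s) = ∏ j, (c j * s ^ (j : ℕ)) := by
  have h1 := prod_upPairs (n := n) h (fun i j => if (i : ℕ) = j then c j else if i < j then s else 1)
    fun i j hij => by
      have h2 : (i : ℕ) ≠ j := by rw [Fin.lt_def] at hij; omega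
      simp [h2, not_lt.mpr hij.le]
  rw [Fintype.prod_prod_type_right] at h1
  trans ∏ j : Fin p, ∏ i : Fin p, if (i : ℕ) = j then c j else if i < j then s else 1
  · rw [← h1]
    refine Finset.prod_congr rfl fun a _ => ?_
    have h2 := a.2
    simp only [Fin.lt_def]
    split_ifs with h3 h4
    · rfl
    · rfl
    · omega
  · refine Finset.prod_congr rfl fun j _ => ?_
    trans ∏ i : Fin p, ((if i = j then c j else 1) * if i < j then s else 1)
    · refine Finset.prod_congr rfl fun i _ => ?_
      simp only [Fin.val_inj]
      by_cases hij : i = j <;> simp [hij]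
    · rw [Finset.prod_mul_distrib, Finset.prod_ite_eq' Finset.univ j, if_pos (Finset.mem_univ _),
        ← Finset.prod_filter, Finset.prod_const]
      congr 2
      rw [← Fin.card_Iio j]
      congr 1
      ext i
      simp

theorem qrConst_eq {n p : ℕ} (h : p ≤ n) :
    qrConst h = ENNReal.ofReal (∏ j : Fin p,
      (Real.Gamma (((n : ℝ) - j) / 2) / 2 * √Real.pi ^ (j : ℕ))) := by
  let f : UpPairs n p → ℝ → ℝ := fun a =>
    if (a.1.1 : ℕ) = a.1.2 then
      (Set.Ioi 0).indicator fun s => s ^ (n - 1 - (a.1.2 : ℕ)) * Real.exp (-s ^ 2)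
    else fun s => Real.exp (-s ^ 2)
  have hfi : ∀ a, Integrable (f a) := by
    intro a
    by_cases ha : (a.1.1 : ℕ) = a.1.2
    · simp only [f, ha, if_true]
      exact (integrableOn_Ioi_pow_mul_exp_neg_sq _).integrable_indicator measurableSet_Ioi
    · simp only [f, ha, if_false]
      exact integrable_exp_neg_sq
  have hf0 : ∀ a s, 0 ≤ f a s := by
    intro a s
    by_cases ha : (a.1.1 : ℕ) = a.1.2
    · simp only [f, ha, if_true]
      exact Set.indicator_nonneg
        (fun s hs => mul_nonneg (pow_nonneg (le_of_lt hs) _) (Real.exp_pos _).le) _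
    · simp only [f, ha, if_false]
      exact (Real.exp_pos _).le
  have hint : ∀ a, ∫ s, f a s = if (a.1.1 : ℕ) = a.1.2 then
      Real.Gamma (((n : ℝ) - (a.1.2 : ℕ)) / 2) / 2 else √Real.pi := by
    intro a
    by_cases ha : (a.1.1 : ℕ) = a.1.2
    · simp only [f, ha, if_true]
      have h2 := a.1.2.2
      rw [integral_indicator measurableSet_Ioi, integral_Ioi_pow_mul_exp_neg_sq]
      congr 3
      rw [Nat.cast_sub (by omega), Nat.cast_sub (by omega)]
      push_cast
      ring
    · simp only [f, ha, if_false]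
      exact integral_exp_neg_sq
  have hprod := lintegral_ofReal_prod hfi hf0
  simp_rw [hint] at hprod
  rw [prod_upPairs_diag h (fun j => Real.Gamma (((n : ℝ) - (j : ℕ)) / 2) / 2)] at hprod
  rw [← hprod, qrConst, ← lintegral_indicator (isOpen_posDiag h).measurableSet]
  refine lintegral_congr fun t => ?_
  have hdiag : ∀ a : UpPairs n p, (a.1.1 : ℕ) = a.1.2 → upTri h t a.1.2 a.1.2 = t a := by
    intro a ha
    rw [← upTri_apply h t a]
    congr 1
    exact Fin.ext ha.symm
  by_cases ht : t ∈ posDiag h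
  · rw [Set.indicator_of_mem ht, gaussWeight, ← ENNReal.ofReal_mul
      (Finset.prod_nonneg fun _ _ => abs_nonneg _)]
    congr 1
    have h3 := prod_upPairs_diag (n := n) h (fun j => upTri h t j j ^ (n - 1 - (j : ℕ))) 1
    simp only [one_pow, mul_one] at h3
    rw [prod_pairs h fun j => |upTri h t j j|]
    simp_rw [fun j => abs_of_pos (ht j)]
    rw [← h3, ← Finset.sum_neg_distrib, Real.exp_sum, ← Finset.prod_mul_distrib]
    refine Finset.prod_congr rfl fun a _ => ?_
    by_cases ha : (a.1.1 : ℕ) = a.1.2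
    · have h4 : 0 < t a := hdiag a ha ▸ ht a.1.2
      simp only [f, ha, if_true, hdiag a ha]
      rw [Set.indicator_of_mem (Set.mem_Ioi.mpr h4)]
    · simp only [f, ha, if_false, one_mul]
  · rw [Set.indicator_of_notMem ht]
    simp only [posDiag, Set.mem_ofPred_eq, not_forall] at ht
    obtain ⟨j, hj⟩ := ht
    let a : UpPairs n p := ⟨(Fin.castLE h j, j), by simp⟩
    have ha : (a.1.1 : ℕ) = a.1.2 := rfl
    rw [Finset.prod_eq_zero (Finset.mem_univ a), ENNReal.ofReal_zero]
    simp only [f, ha, if_true]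
    refine Set.indicator_of_notMem ?_ _
    rw [← hdiag a ha]
    exact hj

theorem qrConst_ne_zero {n p : ℕ} (h : p ≤ n) : qrConst h ≠ 0 := by
  rw [qrConst_eq, ne_eq, ENNReal.ofReal_eq_zero, not_le]
  refine Finset.prod_pos fun j _ => mul_pos (half_pos (Real.Gamma_pos_of_pos (half_pos ?_)))
    (pow_pos (Real.sqrt_pos.mpr Real.pi_pos) _)
  rw [sub_pos, Nat.cast_lt]
  omega

theorem qrConst_ne_top {n p : ℕ} (h : p ≤ n) : qrConst h ≠ ⊤ := by
  rw [qrConst_eq]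
  exact ENNReal.ofReal_ne_top

/-- The total volume. -/
theorem gaussMeasure_univ_div_qrConst {n p : ℕ} (h : p ≤ n) :
    (qrConst h)⁻¹ * gaussMeasure (Fin n × Fin p) Set.univ =
      ENNReal.ofReal (2 ^ p * Real.pi ^ ((p : ℝ) * (n : ℝ) / 2) / multiGamma p ((n : ℝ) / 2)) := by
  have hpos : 0 < ∏ j : Fin p, (Real.Gamma (((n : ℝ) - j) / 2) / 2 * √Real.pi ^ (j : ℕ)) := by
    by_contra hc
    exact qrConst_ne_zero h (by rw [qrConst_eq, ENNReal.ofReal_eq_zero]; exact not_lt.mp hc)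
  rw [qrConst_eq, gaussMeasure_univ, ← ENNReal.ofReal_inv_of_pos hpos,
    ← ENNReal.ofReal_mul (inv_nonneg.mpr hpos.le), inv_mul_eq_div]
  congr 1
  have h1 : √Real.pi ^ Fintype.card (Fin n × Fin p) = Real.pi ^ ((p : ℝ) * (n : ℝ) / 2) := by
    rw [Real.sqrt_eq_rpow, ← Real.rpow_natCast, ← Real.rpow_mul Real.pi_pos.le]
    congr 1
    simp
    ring
  have h2 : ∏ j : Fin p, √Real.pi ^ (j : ℕ) = Real.pi ^ ((p : ℝ) * ((p : ℝ) - 1) / 4) := by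
    rw [Finset.prod_pow_eq_pow_sum, Real.sqrt_eq_rpow, ← Real.rpow_natCast,
      ← Real.rpow_mul Real.pi_pos.le]
    congr 1
    rw [Fin.sum_univ_eq_sum_range (fun i => i) p]
    have h3 := Finset.sum_range_id_mul_two p
    have h4 : ((∑ i ∈ Finset.range p, i : ℕ) : ℝ) * 2 = p * (p - 1) := by
      rcases p with _ | p
      · simp
      · rw [← Nat.cast_two, ← Nat.cast_mul, h3]
        push_cast
        ring
    linarith
  rw [h1, multiGamma, Finset.prod_mul_distrib, h2, Finset.prod_div_distrib, Finset.prod_const,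
    Finset.card_univ, Fintype.card_fin]
  simp_rw [← sub_div]
  rw [div_mul_eq_mul_div, div_div_eq_mul_div, mul_comm _ ((2 : ℝ) ^ p), mul_comm (Finset.prod _ _)]

open InnerProductSpace in
/-- Existence of the `QR` decomposition. -/
theorem mem_qrDomain_of_linearIndependent {n p : ℕ} (h : p ≤ n)
    {f : Fin p → EuclideanSpace ℝ (Fin n)} (hf : LinearIndependent ℝ f) :
    (fun a : Fin n × Fin p => f a.2 a.1) ∈ qrDomain h := by
  set g := gramSchmidt ℝ f
  have hg : ∀ j, 0 < ‖g j‖ := fun j => norm_pos_iff.mpr (gramSchmidt_ne_zero j hf)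
  have hq : ∀ j, gramSchmidtNormed ℝ f j = ‖g j‖⁻¹ • g j := fun j => rfl
  refine ⟨Matrix.of fun k j => gramSchmidtNormed ℝ f j k, ?_,
    fun a => if (a.1.1 : ℕ) = a.1.2 then ‖g a.1.2‖
      else inner ℝ (gramSchmidtNormed ℝ f ⟨a.1.1, by have := a.2; omega⟩) (f a.1.2), ?_, ?_⟩
  · have horth := orthonormal_iff_ite.mp (gramSchmidtNormed_orthonormal hf)
    change _ * _ = _
    ext i j
    have := horth i j
    rw [PiLp.inner_apply] at this
    simp only [Matrix.mul_apply, Matrix.transpose_apply, Matrix.of_apply, Matrix.one_apply]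
    rw [← this]
    exact Finset.sum_congr rfl fun k _ => by simp [mul_comm]
  · intro j
    simp only [upTri, Matrix.of_apply, le_refl, dif_pos, Fin.val_castLE, if_true]
    exact hg j
  · ext ⟨k, j⟩
    have h1 := congrArg (fun v : EuclideanSpace ℝ (Fin n) => v k) (gramSchmidt_def'' ℝ f j)
    simp only [PiLp.add_apply, PiLp.smul_apply, WithLp.ofLp_sum, Finset.sum_apply] at h1
    simp only
    rw [h1, qrProd, Matrix.mul_apply]
    simp only [upTri, Matrix.of_apply, Fin.val_castLE, Fin.val_inj]
    trans ∑ i, ((if i = j then g j k else 0) +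
      if i < j then (inner ℝ (g i) (f j) / ‖g i‖ ^ 2) * g i k else 0)
    · refine Finset.sum_congr rfl fun i _ => ?_
      rcases lt_trichotomy i j with hij | rfl | hij
      · have := (hg i).ne'
        simp only [hq, PiLp.smul_apply, smul_eq_mul, hij.le, dif_pos, hij.ne, if_false, hij,
          if_true, zero_add, Fin.eta, real_inner_smul_left]
        field_simp
      · have := (hg i).ne'
        simp only [hq, PiLp.smul_apply, smul_eq_mul, le_refl, dif_pos, if_true, lt_irrefl,
          if_false, add_zero]
        field_simp
      · simp [hij.not_ge, hij.ne', hij.not_gt]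
    · rw [Finset.sum_add_distrib, Finset.sum_ite_eq' Finset.univ j, if_pos (Finset.mem_univ _),
        ← Finset.sum_filter]
      congr 1
      refine Finset.sum_congr (by ext; simp) fun i _ => ?_
      simp [g]

theorem ae_det_ne_zero {n p : ℕ} (h : p ≤ n) : ∀ᵐ X : Fin n × Fin p → ℝ,
    (Matrix.of fun i j : Fin p => X (Fin.castLE h i, j)).det ≠ 0 := by
  have hcont : Continuous fun X : Fin n × Fin p → ℝ =>
      (Matrix.of fun i j : Fin p => X (Fin.castLE h i, j)).det :=
    Continuous.matrix_det (continuous_pi fun i => continuous_pi fun j => continuous_apply _)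
  have hs : MeasurableSet {X : Fin n × Fin p → ℝ |
      (Matrix.of fun i j : Fin p => X (Fin.castLE h i, j)).det ≠ 0} :=
    (isOpen_ne_fun hcont continuous_const).measurableSet
  let L : ℝ →ₗ[ℝ] (Fin n × Fin p → ℝ) :=
    LinearMap.toSpanSingleton ℝ _ fun a => if (a.1 : ℕ) = a.2 then 1 else 0
  refine ae_mem_of_ae_add_linearMap_mem L volume volume hs fun y => ?_
  let M : Matrix (Fin p) (Fin p) ℝ := Matrix.of fun i j : Fin p => - y (Fin.castLE h i, j)
  have hfin : {t : ℝ | M.charpoly.IsRoot t}.Finite :=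
    Polynomial.finite_setOfPred_isRoot M.charpoly_monic.ne_zero
  filter_upwards [hfin.countable.ae_notMem volume] with t ht
  simp only [Polynomial.IsRoot, Matrix.eval_charpoly] at ht ⊢
  convert ht using 3
  ext i j
  have h1 : Matrix.scalar (Fin p) t i j = if i = j then t else 0 := by
    rw [Matrix.scalar_apply, Matrix.diagonal_apply]
  rw [Matrix.sub_apply, h1]
  simp only [L, M, Matrix.of_apply, Pi.add_apply, LinearMap.toSpanSingleton_apply, Pi.smul_apply,
    smul_eq_mul, Fin.val_castLE, Fin.val_inj, mul_ite, mul_one, mul_zero, sub_neg_eq_add]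
  exact add_comm _ _

theorem ae_mem_qrDomain {n p : ℕ} (h : p ≤ n) :
    ∀ᵐ X : Fin n × Fin p → ℝ, X ∈ qrDomain h := by
  filter_upwards [ae_det_ne_zero h] with X hX
  refine mem_qrDomain_of_linearIndependent h (f := fun j => WithLp.toLp 2 fun k => X (k, j)) ?_
  rw [Fintype.linearIndependent_iff]
  intro c hc
  have h1 : (Matrix.of fun i j : Fin p => X (Fin.castLE h i, j)).mulVec c = 0 := by
    ext i
    have := congrArg (fun v : EuclideanSpace ℝ (Fin n) => v (Fin.castLE h i)) hc
    simp only [WithLp.ofLp_sum, Finset.sum_apply, PiLp.smul_apply, PiLp.zero_apply] at this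
    simp only [Matrix.mulVec, dotProduct, Matrix.of_apply, Pi.zero_apply]
    rw [← this]
    exact Finset.sum_congr rfl fun j _ => mul_comm _ _
  exact congrFun (Matrix.eq_zero_of_mulVec_eq_zero hX h1)

/-- The volume of the Stiefel manifold, as the image of a Gaussian measure. -/
def qrMeasure {n p : ℕ} (h : p ≤ n) : Measure (Matrix (Fin n) (Fin p) ℝ) :=
  (qrConst h)⁻¹ • (gaussMeasure (Fin n × Fin p)).map (qrFactor h)

theorem ae_gaussMeasure_mem_qrDomain {n p : ℕ} (h : p ≤ n) :
    ∀ᵐ X ∂gaussMeasure (Fin n × Fin p), X ∈ qrDomain h :=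
  (withDensity_absolutelyContinuous _ _).ae_le (ae_mem_qrDomain h)

theorem qrMeasure_apply {n p : ℕ} (h : p ≤ n) {A : Set (Matrix (Fin n) (Fin p) ℝ)}
    (hA : MeasurableSet A) : qrMeasure h A = (qrConst h)⁻¹ * gaussMeasure (Fin n × Fin p)
      {X | ∃ U ∈ A ∩ stiefel n p, ∃ t ∈ posDiag h, qrProd h U t = X} := by
  rw [qrMeasure, Measure.smul_apply, Measure.map_apply (measurable_qrFactor h) hA, smul_eq_mul]
  congr 1
  refine measure_congr ?_
  filter_upwards [ae_gaussMeasure_mem_qrDomain h] with X hX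
  obtain ⟨U, hU, t, ht, rfl⟩ := hX
  refine propext ?_
  change qrFactor h (qrProd h U t) ∈ A ↔ _
  rw [qrFactor_qrProd h hU ht]
  constructor
  · exact fun hUA => ⟨U, ⟨hUA, hU⟩, t, ht, rfl⟩
  · rintro ⟨U', hU', t', ht', heq⟩
    rw [← (qrProd_injOn h hU'.2 hU ht' ht heq).1]
    exact hU'.1

theorem qrMeasure_univ {n p : ℕ} (h : p ≤ n) : qrMeasure h Set.univ =
    ENNReal.ofReal (2 ^ p * Real.pi ^ ((p : ℝ) * (n : ℝ) / 2) / multiGamma p ((n : ℝ) / 2)) := by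
  rw [← gaussMeasure_univ_div_qrConst h, qrMeasure, Measure.smul_apply,
    Measure.map_apply (measurable_qrFactor h) MeasurableSet.univ, Set.preimage_univ, smul_eq_mul]

theorem qrMeasure_compl_stiefel {n p : ℕ} (h : p ≤ n) : qrMeasure h (stiefel n p)ᶜ = 0 := by
  rw [qrMeasure_apply h (measurableSet_stiefel n p).compl]
  simp

theorem qrMeasure_inter_stiefel {n p : ℕ} (h : p ≤ n) (A : Set (Matrix (Fin n) (Fin p) ℝ)) :
    qrMeasure h (A ∩ stiefel n p) = qrMeasure h A :=
  measure_inter_conull (qrMeasure_compl_stiefel h)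

theorem IsParam.measurableSet_image {n p : ℕ} {Ω : Set (Pairs n p → ℝ)}
    {φ : (Pairs n p → ℝ) → Matrix (Fin n) (Fin p) ℝ} (hφ : IsParam (stiefel n p) Ω φ) :
    MeasurableSet (φ '' Ω) :=
  hφ.isOpen.measurableSet.image_of_continuousOn_injOn
    (β := Fin n → Fin p → ℝ) hφ.contDiffOn.continuousOn hφ.injOn

theorem qrMeasure_restrict_image {n p : ℕ} (h : p ≤ n) {Ω : Set (Pairs n p → ℝ)}
    {φ : (Pairs n p → ℝ) → Matrix (Fin n) (Fin p) ℝ} (hφ : IsParam (stiefel n p) Ω φ) :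
    (qrMeasure h).restrict (φ '' Ω) = paramMeasure (stiefelDensity h) Ω φ := by
  ext A hA
  have h1 : A ∩ φ '' Ω ∩ stiefel n p = A ∩ φ '' Ω :=
    Set.inter_eq_left.mpr (Set.inter_subset_right.trans (Set.image_subset_iff.mpr hφ.mapsTo))
  rw [Measure.restrict_apply hA, qrMeasure_apply h (hA.inter hφ.measurableSet_image), h1,
    gaussMeasure_qrProd_image h hφ hA, ← mul_assoc,
    ENNReal.inv_mul_cancel (qrConst_ne_zero h) (qrConst_ne_top h), one_mul]

/-- The skew-symmetric part of the Cayley coordinates. -/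
def cayleySkew {n p : ℕ} (h : p ≤ n) (x : Pairs n p → ℝ) : Matrix (Fin p) (Fin p) ℝ :=
  Matrix.of fun i j =>
    if hij : j < i then x ⟨(Fin.castLE h i, j), hij⟩
    else if hji : i < j then - x ⟨(Fin.castLE h j, i), hji⟩ else 0

/-- The normal part of the Cayley coordinates. -/
def cayleyLow {n p : ℕ} (x : Pairs n p → ℝ) : Matrix (Fin n) (Fin p) ℝ :=
  Matrix.of fun i j => if hi : p ≤ (i : ℕ) then x ⟨(i, j), by simp only; omega⟩ else 0

/-- The matrix `U₀ + U₂ * B`, where `[U₀ U₂]` is orthogonal. -/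
def cayleyBase {n p : ℕ} (h : p ≤ n) (U₀ : Matrix (Fin n) (Fin p) ℝ) (x : Pairs n p → ℝ) :
    Matrix (Fin n) (Fin p) ℝ :=
  U₀ + completion h U₀ * cayleyLow x

/-- The denominator in the Cayley parametrization. -/
def cayleyDen {n p : ℕ} (h : p ≤ n) (U₀ : Matrix (Fin n) (Fin p) ℝ) (x : Pairs n p → ℝ) :
    Matrix (Fin p) (Fin p) ℝ :=
  cayleySkew h x + (cayleyBase h U₀ x).transpose * cayleyBase h U₀ x

/-- The Cayley parametrization of the Stiefel manifold around `U₀`. -/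
def cayleyParam {n p : ℕ} (h : p ≤ n) (U₀ : Matrix (Fin n) (Fin p) ℝ) (x : Pairs n p → ℝ) :
    Matrix (Fin n) (Fin p) ℝ :=
  (2 : ℝ) • (cayleyBase h U₀ x * (cayleyDen h U₀ x)⁻¹) - U₀

theorem cayleySkew_transpose {n p : ℕ} (h : p ≤ n) (x : Pairs n p → ℝ) :
    (cayleySkew h x).transpose = - cayleySkew h x := by
  ext i j
  rw [Matrix.transpose_apply, Matrix.neg_apply]
  rcases lt_trichotomy i j with hij | rfl | hij
  · simp [cayleySkew, hij, hij.not_gt]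
  · simp [cayleySkew]
  · simp [cayleySkew, hij, hij.not_gt]

theorem transpose_mul_completion {n p : ℕ} (h : p ≤ n) {U₀ : Matrix (Fin n) (Fin p) ℝ}
    (hU : U₀ ∈ stiefel n p) : U₀.transpose * completion h U₀ =
      Matrix.of fun j i => if i = Fin.castLE h j then 1 else 0 := by
  obtain ⟨hV, hVU⟩ := completion_spec h hU
  have hVV : (completion h U₀).transpose * completion h U₀ = 1 :=
    (Matrix.mem_orthogonalGroup_iff' (Fin n) ℝ).mp hV
  ext j i
  have := congrFun (congrFun hVV (Fin.castLE h j)) i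
  rw [Matrix.one_apply] at this
  rw [Matrix.of_apply, if_congr eq_comm rfl rfl, ← this, Matrix.mul_apply, Matrix.mul_apply]
  exact Finset.sum_congr rfl fun k _ => by
    rw [Matrix.transpose_apply, Matrix.transpose_apply, hVU]

theorem transpose_mul_completion_mul {n p : ℕ} (h : p ≤ n) {U₀ : Matrix (Fin n) (Fin p) ℝ}
    (hU : U₀ ∈ stiefel n p) (X : Matrix (Fin n) (Fin p) ℝ) (i j : Fin p) :
    (U₀.transpose * (completion h U₀ * X)) i j = X (Fin.castLE h i) j := by
  rw [← Matrix.mul_assoc, transpose_mul_completion h hU, Matrix.mul_apply]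
  simp

theorem transpose_mul_cayleyBase {n p : ℕ} (h : p ≤ n) {U₀ : Matrix (Fin n) (Fin p) ℝ}
    (hU : U₀ ∈ stiefel n p) (x : Pairs n p → ℝ) : U₀.transpose * cayleyBase h U₀ x = 1 := by
  have h1 : U₀.transpose * U₀ = 1 := hU
  have h2 : U₀.transpose * (completion h U₀ * cayleyLow x) = 0 := by
    ext i j
    rw [transpose_mul_completion_mul h hU]
    simp [cayleyLow]
  rw [cayleyBase, Matrix.mul_add, h1, h2, add_zero]

theorem isUnit_det_cayleyDen {n p : ℕ} (h : p ≤ n) {U₀ : Matrix (Fin n) (Fin p) ℝ}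
    (hU : U₀ ∈ stiefel n p) (x : Pairs n p → ℝ) : IsUnit (cayleyDen h U₀ x).det := by
  rw [isUnit_iff_ne_zero]
  intro hdet
  obtain ⟨v, hv, hMv⟩ := Matrix.exists_mulVec_eq_zero_iff.mpr hdet
  apply hv
  set Z := cayleyBase h U₀ x
  have h1 : dotProduct v ((cayleySkew h x).mulVec v) = 0 := by
    have h2 : dotProduct v ((cayleySkew h x).mulVec v) =
        dotProduct v ((cayleySkew h x).transpose.mulVec v) := by
      rw [Matrix.mulVec_transpose, Matrix.dotProduct_mulVec, dotProduct_comm]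
    rw [cayleySkew_transpose, Matrix.neg_mulVec, dotProduct_neg] at h2
    linarith
  have h3 : dotProduct (Z.mulVec v) (Z.mulVec v) = 0 := by
    have h4 : dotProduct v ((cayleyDen h U₀ x).mulVec v) = 0 := by rw [hMv, dotProduct_zero]
    rw [cayleyDen, Matrix.add_mulVec, dotProduct_add, h1, zero_add, ← Matrix.mulVec_mulVec,
      Matrix.dotProduct_mulVec, Matrix.vecMul_transpose] at h4
    exact h4
  have h5 : Z.mulVec v = 0 := dotProduct_self_eq_zero.mp h3
  have h6 : U₀.transpose.mulVec (Z.mulVec v) = v := by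
    rw [Matrix.mulVec_mulVec, transpose_mul_cayleyBase h hU, Matrix.one_mulVec]
  rw [← h6, h5, Matrix.mulVec_zero]

theorem cayleyParam_add {n p : ℕ} (h : p ≤ n) (U₀ : Matrix (Fin n) (Fin p) ℝ)
    (x : Pairs n p → ℝ) :
    cayleyParam h U₀ x + U₀ = (2 : ℝ) • (cayleyBase h U₀ x * (cayleyDen h U₀ x)⁻¹) :=
  sub_add_cancel _ _

theorem transpose_mul_cayleyParam_add {n p : ℕ} (h : p ≤ n) {U₀ : Matrix (Fin n) (Fin p) ℝ}
    (hU : U₀ ∈ stiefel n p) (x : Pairs n p → ℝ) :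
    U₀.transpose * (cayleyParam h U₀ x + U₀) = (2 : ℝ) • (cayleyDen h U₀ x)⁻¹ := by
  rw [cayleyParam_add, Matrix.mul_smul, ← Matrix.mul_assoc, transpose_mul_cayleyBase h hU,
    Matrix.one_mul]

/-- If `W = U₀ᵀ (U + U₀)`, then `U` is in the Stiefel manifold iff
`(U + U₀)ᵀ (U + U₀) = W + Wᵀ`. -/
theorem mem_stiefel_iff_add {n p : ℕ} {U₀ : Matrix (Fin n) (Fin p) ℝ}
    (hU : U₀ ∈ stiefel n p) (U : Matrix (Fin n) (Fin p) ℝ) :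
    U ∈ stiefel n p ↔ (U + U₀).transpose * (U + U₀) =
      U₀.transpose * (U + U₀) + (U₀.transpose * (U + U₀)).transpose := by
  have h1 : U₀.transpose * U₀ = 1 := hU
  change U.transpose * U = 1 ↔ _
  simp only [Matrix.transpose_add, Matrix.transpose_mul, Matrix.transpose_transpose,
    Matrix.add_mul, Matrix.mul_add, h1, Matrix.transpose_one]
  constructor
  · intro h2
    rw [h2]
    abel
  · intro h2
    have h3 : U.transpose * U = U.transpose * U + U₀.transpose * U + (U.transpose * U₀ + 1) -
      (U₀.transpose * U + U.transpose * U₀ + 1) := by abel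
    rw [h3, h2]
    abel

theorem cayleyParam_mem {n p : ℕ} (h : p ≤ n) {U₀ : Matrix (Fin n) (Fin p) ℝ}
    (hU : U₀ ∈ stiefel n p) (x : Pairs n p → ℝ) : cayleyParam h U₀ x ∈ stiefel n p := by
  rw [mem_stiefel_iff_add hU, transpose_mul_cayleyParam_add h hU, cayleyParam_add]
  set Z := cayleyBase h U₀ x
  set M := cayleyDen h U₀ x with hM
  have hu : IsUnit M.det := isUnit_det_cayleyDen h hU x
  have hut : IsUnit M.transpose.det := by rwa [Matrix.det_transpose]
  have hMM : M + M.transpose = (2 : ℝ) • (Z.transpose * Z) := by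
    rw [hM, cayleyDen, Matrix.transpose_add, cayleySkew_transpose, Matrix.transpose_mul,
      Matrix.transpose_transpose, two_smul]
    abel
  have h1 : (M⁻¹).transpose * (M + M.transpose) * M⁻¹ = (M⁻¹).transpose + M⁻¹ := by
    rw [Matrix.mul_add, Matrix.add_mul, Matrix.mul_assoc, Matrix.mul_nonsing_inv M hu,
      Matrix.mul_one, Matrix.transpose_nonsing_inv, Matrix.nonsing_inv_mul _ hut, Matrix.one_mul]
  rw [hMM] at h1
  simp only [Matrix.transpose_smul, Matrix.transpose_mul, Matrix.smul_mul, Matrix.mul_smul]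
    at h1 ⊢
  rw [← smul_add, add_comm M⁻¹, ← h1]
  simp only [Matrix.mul_assoc]

theorem ext_of_cayley {n p : ℕ} (h : p ≤ n) {U₀ : Matrix (Fin n) (Fin p) ℝ}
    (hU : U₀ ∈ stiefel n p) {x x' : Pairs n p → ℝ} (hZ : cayleyBase h U₀ x = cayleyBase h U₀ x')
    (hA : cayleySkew h x = cayleySkew h x') : x = x' := by
  have hVV : (completion h U₀).transpose * completion h U₀ = 1 :=
    (Matrix.mem_orthogonalGroup_iff' (Fin n) ℝ).mp (completion_spec h hU).1
  have hlow : cayleyLow (p := p) x = cayleyLow x' := by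
    have := congrArg ((completion h U₀).transpose * ·) (add_left_cancel hZ)
    simpa only [← Matrix.mul_assoc, hVV, Matrix.one_mul] using this
  ext ⟨⟨i, j⟩, hij⟩
  simp only at hij
  by_cases hi : p ≤ (i : ℕ)
  · simpa [cayleyLow, hi] using congrFun (congrFun hlow i) j
  · have := congrFun (congrFun hA ⟨i, by omega⟩) j
    have hlt : j < ⟨i, by omega⟩ := hij
    simp only [cayleySkew, Matrix.of_apply, hlt, dif_pos] at this
    exact this

theorem cayleyParam_injective {n p : ℕ} (h : p ≤ n) {U₀ : Matrix (Fin n) (Fin p) ℝ}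
    (hU : U₀ ∈ stiefel n p) : Function.Injective (cayleyParam h U₀) := by
  intro x x' hx
  have h1 := transpose_mul_cayleyParam_add h hU x
  rw [hx, transpose_mul_cayleyParam_add h hU] at h1
  have hu := isUnit_det_cayleyDen h hU x
  have hu' := isUnit_det_cayleyDen h hU x'
  have hinv : (cayleyDen h U₀ x)⁻¹ = (cayleyDen h U₀ x')⁻¹ :=
    (smul_right_injective _ (two_ne_zero (α := ℝ)) h1).symm
  have hM : cayleyDen h U₀ x = cayleyDen h U₀ x' := by
    rw [← Matrix.nonsing_inv_nonsing_inv _ hu, hinv, Matrix.nonsing_inv_nonsing_inv _ hu']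
  have hZ : cayleyBase h U₀ x = cayleyBase h U₀ x' := by
    have h2 := cayleyParam_add h U₀ x
    rw [hx, cayleyParam_add, hinv] at h2
    have h3 := congrArg (· * cayleyDen h U₀ x') (smul_right_injective _ (two_ne_zero (α := ℝ)) h2)
    simpa only [Matrix.mul_assoc, Matrix.nonsing_inv_mul _ hu', Matrix.mul_one] using h3.symm
  refine ext_of_cayley h hU hZ ?_
  rw [cayleyDen, cayleyDen, hZ] at hM
  exact add_right_cancel hM

theorem exists_cayley_coords {n p : ℕ} (h : p ≤ n) {U₀ Z : Matrix (Fin n) (Fin p) ℝ}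
    (hU : U₀ ∈ stiefel n p) (hZ : U₀.transpose * Z = 1) {A : Matrix (Fin p) (Fin p) ℝ}
    (hA : A.transpose = -A) : ∃ x, cayleyBase h U₀ x = Z ∧ cayleySkew h x = A := by
  have hU1 : U₀.transpose * U₀ = 1 := hU
  have hVV : completion h U₀ * (completion h U₀).transpose = 1 :=
    (Matrix.mem_orthogonalGroup_iff (Fin n) ℝ).mp (completion_spec h hU).1
  set Y := (completion h U₀).transpose * (Z - U₀) with hY
  have hVY : completion h U₀ * Y = Z - U₀ := by rw [hY, ← Matrix.mul_assoc, hVV, Matrix.one_mul]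
  refine ⟨fun a => if ha : (a.1.1 : ℕ) < p then A ⟨a.1.1, ha⟩ a.1.2 else Y a.1.1 a.1.2, ?_, ?_⟩
  · rw [cayleyBase]
    suffices h1 : cayleyLow (n := n) (p := p)
        (fun a => if ha : (a.1.1 : ℕ) < p then A ⟨a.1.1, ha⟩ a.1.2 else Y a.1.1 a.1.2) = Y by
      rw [h1, hVY, add_sub_cancel]
    ext i j
    by_cases hi : p ≤ (i : ℕ)
    · simp [cayleyLow, hi, hi.not_gt]
    · have h2 := transpose_mul_completion_mul h hU Y ⟨i, by omega⟩ j
      rw [hVY, Matrix.mul_sub, hZ, hU1, sub_self, Matrix.zero_apply] at h2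
      simpa [cayleyLow, hi] using h2
  · ext i j
    have hAij : A j i = - A i j := congrFun (congrFun hA i) j
    rcases lt_trichotomy i j with hij | rfl | hij
    · simp [cayleySkew, hij, hij.not_gt, hAij]
    · simp only [cayleySkew, Matrix.of_apply, lt_irrefl, dif_neg, not_false_eq_true]
      linarith
    · simp [cayleySkew, hij]

theorem mem_range_cayleyParam {n p : ℕ} (h : p ≤ n) {U₀ U : Matrix (Fin n) (Fin p) ℝ}
    (hU₀ : U₀ ∈ stiefel n p) (hU : U ∈ stiefel n p)
    (hdet : (U₀.transpose * (U + U₀)).det ≠ 0) : U ∈ Set.range (cayleyParam h U₀) := by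
  set W := U₀.transpose * (U + U₀) with hW
  have hu : IsUnit W.det := isUnit_iff_ne_zero.mpr hdet
  have hut : IsUnit W.transpose.det := by rwa [Matrix.det_transpose]
  set Z := (U + U₀) * W⁻¹ with hZ
  have hUZ : U₀.transpose * Z = 1 := by
    rw [hZ, ← Matrix.mul_assoc, ← hW, Matrix.mul_nonsing_inv W hu]
  have hZZ : Z.transpose * Z = (W⁻¹).transpose + W⁻¹ := by
    rw [hZ, Matrix.transpose_mul, Matrix.mul_assoc, ← Matrix.mul_assoc _ _ W⁻¹,
      (mem_stiefel_iff_add hU₀ U).mp hU, ← hW, Matrix.add_mul, Matrix.mul_add,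
      Matrix.mul_nonsing_inv W hu, Matrix.mul_one, ← Matrix.mul_assoc,
      Matrix.transpose_nonsing_inv, Matrix.nonsing_inv_mul _ hut, Matrix.one_mul]
  have hA : ((2 : ℝ) • W⁻¹ - Z.transpose * Z).transpose = -((2 : ℝ) • W⁻¹ - Z.transpose * Z) := by
    rw [hZZ, Matrix.transpose_sub, Matrix.transpose_smul, Matrix.transpose_add,
      Matrix.transpose_transpose, two_smul, two_smul]
    abel
  obtain ⟨x, hx1, hx2⟩ := exists_cayley_coords h hU₀ hUZ hA
  refine ⟨x, ?_⟩
  have hden : cayleyDen h U₀ x = (2 : ℝ) • W⁻¹ := by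
    rw [cayleyDen, hx1, hx2, sub_add_cancel]
  have hinv : (cayleyDen h U₀ x)⁻¹ = (2 : ℝ)⁻¹ • W := by
    apply Matrix.inv_eq_left_inv
    rw [hden, Matrix.smul_mul, Matrix.mul_smul, Matrix.mul_nonsing_inv W hu, smul_smul,
      inv_mul_cancel₀ two_ne_zero, one_smul]
  rw [cayleyParam, hinv, hx1, Matrix.mul_smul, smul_smul, mul_inv_cancel₀ two_ne_zero, one_smul,
    hZ, Matrix.mul_assoc, Matrix.nonsing_inv_mul W hu, Matrix.mul_one, add_sub_cancel_right]

theorem contDiff_det {E : Type*} [NormedAddCommGroup E] [NormedSpace ℝ E] {m : ℕ}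
    {M : E → Matrix (Fin m) (Fin m) ℝ} (hM : ∀ i j, ContDiff ℝ 1 fun x => M x i j) :
    ContDiff ℝ 1 fun x => (M x).det := by
  simp only [Matrix.det_apply]
  exact ContDiff.sum fun σ _ => ContDiff.const_smul _ (contDiff_prod fun i _ => hM _ _)

theorem contDiff_mul_entry {E : Type*} [NormedAddCommGroup E] [NormedSpace ℝ E] {k m l : Type*}
    [Fintype m] {M : E → Matrix k m ℝ} {N : E → Matrix m l ℝ}
    (hM : ∀ i j, ContDiff ℝ 1 fun x => M x i j) (hN : ∀ i j, ContDiff ℝ 1 fun x => N x i j)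
    (i : k) (j : l) : ContDiff ℝ 1 fun x => (M x * N x) i j := by
  simp only [Matrix.mul_apply]
  exact ContDiff.sum fun c _ => (hM _ _).mul (hN _ _)

theorem contDiff_inv_entry {E : Type*} [NormedAddCommGroup E] [NormedSpace ℝ E] {m : ℕ}
    {M : E → Matrix (Fin m) (Fin m) ℝ} (hM : ∀ i j, ContDiff ℝ 1 fun x => M x i j)
    (hdet : ∀ x, IsUnit (M x).det) (i j : Fin m) : ContDiff ℝ 1 fun x => (M x)⁻¹ i j := by
  simp only [Matrix.inv_def, Matrix.smul_apply, Ring.inverse_eq_inv', smul_eq_mul,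
    Matrix.adjugate_apply]
  refine ((contDiff_det hM).inv fun x => (hdet x).ne_zero).mul (contDiff_det fun k l => ?_)
  by_cases hk : k = j
  · subst hk
    simp only [Matrix.updateRow_self]
    exact contDiff_const
  · simp only [Matrix.updateRow_ne hk]
    exact hM k l

theorem contDiff_cayleyParam {n p : ℕ} (h : p ≤ n) {U₀ : Matrix (Fin n) (Fin p) ℝ}
    (hU : U₀ ∈ stiefel n p) : ContDiff ℝ 1 (cayleyParam h U₀) := by
  have hlow : ∀ i j, ContDiff ℝ 1 fun x : Pairs n p → ℝ => cayleyLow x i j := by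
    intro i j
    by_cases hi : p ≤ (i : ℕ)
    · simp only [cayleyLow, Matrix.of_apply, hi, dif_pos]
      exact contDiff_apply _ _ _
    · simp only [cayleyLow, Matrix.of_apply, hi, dif_neg, not_false_eq_true]
      exact contDiff_const
  have hskew : ∀ i j, ContDiff ℝ 1 fun x : Pairs n p → ℝ => cayleySkew h x i j := by
    intro i j
    simp only [cayleySkew, Matrix.of_apply]
    split_ifs
    · exact contDiff_apply _ _ _
    · exact (contDiff_apply _ _ _).neg
    · exact contDiff_const
  have hbase : ∀ i j, ContDiff ℝ 1 fun x : Pairs n p → ℝ => cayleyBase h U₀ x i j := by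
    intro i j
    simp only [cayleyBase, Matrix.add_apply]
    exact contDiff_const.add (contDiff_mul_entry
      (M := fun _ => completion h U₀) (fun _ _ => contDiff_const) hlow i j)
  have hden : ∀ i j, ContDiff ℝ 1 fun x : Pairs n p → ℝ => cayleyDen h U₀ x i j := by
    intro i j
    simp only [cayleyDen, Matrix.add_apply]
    exact (hskew i j).add (contDiff_mul_entry (fun i j => hbase j i) hbase i j)
  refine contDiff_pi' fun i => contDiff_pi' fun j => ?_
  simp only [cayleyParam, Matrix.sub_apply, Matrix.smul_apply]
  refine ContDiff.sub (ContDiff.const_smul _ ?_) contDiff_const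
  exact contDiff_mul_entry hbase (contDiff_inv_entry hden (isUnit_det_cayleyDen h hU)) i j

theorem isParam_cayleyParam {n p : ℕ} (h : p ≤ n) {U₀ : Matrix (Fin n) (Fin p) ℝ}
    (hU : U₀ ∈ stiefel n p) : IsParam (stiefel n p) Set.univ (cayleyParam h U₀) where
  isOpen := isOpen_univ
  contDiffOn := (contDiff_cayleyParam h hU).contDiffOn
  injOn := (cayleyParam_injective h hU).injOn
  mapsTo := fun x _ => cayleyParam_mem h hU x

theorem range_cayleyParam_mem_nhdsWithin {n p : ℕ} (h : p ≤ n) {U₀ : Matrix (Fin n) (Fin p) ℝ}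
    (hU : U₀ ∈ stiefel n p) :
    Set.range (cayleyParam h U₀) ∈ nhdsWithin U₀ (stiefel n p) := by
  have hcont : Continuous fun U : Matrix (Fin n) (Fin p) ℝ => (U₀.transpose * (U + U₀)).det :=
    (continuous_const.matrix_mul (continuous_id.add continuous_const)).matrix_det
  have h1 : U₀.transpose * U₀ = 1 := hU
  have h0 : (U₀.transpose * (U₀ + U₀)).det ≠ 0 := by
    rw [Matrix.mul_add, h1, ← two_smul ℝ, Matrix.det_smul, Matrix.det_one, mul_one]
    exact pow_ne_zero _ two_ne_zero
  filter_upwards [self_mem_nhdsWithin,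
    nhdsWithin_le_nhds (hcont.continuousAt.eventually_ne h0)] with U hUs hdet
  exact mem_range_cayleyParam h hU hUs hdet

theorem le_of_restrict_le_of_countable_cover {E : Type*} [MeasurableSpace E] {μ ν : Measure E}
    {T : Set (Set E)} (hT : T.Countable) (hm : ∀ s ∈ T, MeasurableSet s)
    (hle : ∀ s ∈ T, ν.restrict s ≤ μ) (hcov : ν (⋃₀ T)ᶜ = 0) : ν ≤ μ := by
  rcases T.eq_empty_or_nonempty with rfl | hne
  · rw [Set.sUnion_empty, Set.compl_empty, Measure.measure_univ_eq_zero] at hcov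
    rw [hcov]
    exact Measure.zero_le _
  obtain ⟨s, rfl⟩ := hT.exists_eq_range hne
  have hs : ∀ i, MeasurableSet (s i) := fun i => hm _ ⟨i, rfl⟩
  have hd : ∀ i, MeasurableSet (disjointed s i) := fun i => MeasurableSet.disjointed hs i
  refine Measure.le_iff.mpr fun A hA => ?_
  have hdisj : Pairwise (Function.onFun Disjoint fun i => A ∩ disjointed s i) := fun i j hij =>
    (disjoint_disjointed s hij).mono Set.inter_subset_right Set.inter_subset_right
  calc ν A = ν (A ∩ ⋃₀ Set.range s) := (measure_inter_conull hcov).symm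
    _ = ν (⋃ i, A ∩ disjointed s i) := by
        rw [Set.sUnion_range, ← iUnion_disjointed, Set.inter_iUnion]
    _ = ∑' i, ν (A ∩ disjointed s i) := measure_iUnion hdisj fun i => hA.inter (hd i)
    _ ≤ ∑' i, μ (A ∩ disjointed s i) := by
        refine ENNReal.tsum_le_tsum fun i => ?_
        have h1 := hle _ ⟨i, rfl⟩ (A ∩ disjointed s i)
        rwa [Measure.restrict_apply (hA.inter (hd i)), Set.inter_eq_left.mpr
          (Set.inter_subset_right.trans (disjointed_subset s i))] at h1
    _ = μ (⋃ i, A ∩ disjointed s i) := (measure_iUnion hdisj fun i => hA.inter (hd i)).symm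
    _ ≤ μ A := measure_mono (Set.iUnion_subset fun i => Set.inter_subset_left)

theorem exists_countable_cayley_cover {n p : ℕ} (h : p ≤ n) :
    ∃ t ⊆ stiefel n p, t.Countable ∧ stiefel n p ⊆ ⋃ U₀ ∈ t, Set.range (cayleyParam h U₀) := by
  have : SecondCountableTopology (Matrix (Fin n) (Fin p) ℝ) :=
    inferInstanceAs (SecondCountableTopology (Fin n → Fin p → ℝ))
  exact TopologicalSpace.countable_cover_nhdsWithin fun U₀ hU =>
    range_cayleyParam_mem_nhdsWithin h hU

theorem stiefelMeasure_eq_qrMeasure {n p : ℕ} (h : p ≤ n) : stiefelMeasure h = qrMeasure h := by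
  apply le_antisymm
  · refine sSup_le ?_
    rintro _ ⟨Ω, φ, hφ, rfl⟩
    rw [← qrMeasure_restrict_image h hφ]
    exact Measure.restrict_le_self
  · obtain ⟨t, hts, htc, hcov⟩ := exists_countable_cayley_cover (n := n) h
    refine le_of_restrict_le_of_countable_cover
      (T := (fun U₀ => cayleyParam h U₀ '' Set.univ) '' t) (htc.image _) ?_ ?_ ?_
    · rintro _ ⟨U₀, hU₀, rfl⟩
      exact (isParam_cayleyParam h (hts hU₀)).measurableSet_image
    · rintro _ ⟨U₀, hU₀, rfl⟩
      have hφ := isParam_cayleyParam h (hts hU₀)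
      rw [qrMeasure_restrict_image h hφ]
      exact le_sSup ⟨_, _, hφ, rfl⟩
    · refine measure_mono_null (Set.compl_subset_compl.mpr ?_) (qrMeasure_compl_stiefel h)
      rw [Set.sUnion_image]
      simpa only [Set.image_univ] using hcov

/-- Left multiplication by a matrix, on vectors of entries. -/
def leftMul {n : ℕ} (p : ℕ) (V : Matrix (Fin n) (Fin n) ℝ) :
    (Fin n × Fin p → ℝ) →ₗ[ℝ] (Fin n × Fin p → ℝ) :=
  Matrix.toLin' (Matrix.kroneckerMap (· * ·) V (1 : Matrix (Fin p) (Fin p) ℝ))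

theorem leftMul_apply {n p : ℕ} (V : Matrix (Fin n) (Fin n) ℝ) (X : Fin n × Fin p → ℝ)
    (a : Fin n × Fin p) :
    leftMul p V X a = (V * Matrix.of fun i j => X (i, j)) a.1 a.2 := by
  rw [leftMul, Matrix.toLin'_apply, Matrix.mulVec, dotProduct, Fintype.sum_prod_type,
    Matrix.mul_apply]
  refine Finset.sum_congr rfl fun k _ => ?_
  rw [Finset.sum_eq_single a.2]
  · simp [Matrix.kroneckerMap_apply]
  · intro c _ hc
    simp [Matrix.kroneckerMap_apply, Matrix.one_apply_ne hc.symm]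
  · simp

theorem leftMul_qrProd {n p : ℕ} (h : p ≤ n) (V : Matrix (Fin n) (Fin n) ℝ)
    (U : Matrix (Fin n) (Fin p) ℝ) (t : UpPairs n p → ℝ) :
    leftMul p V (qrProd h U t) = qrProd h (V * U) t := by
  ext a
  rw [leftMul_apply, qrProd, Matrix.mul_assoc]
  rfl

theorem leftMul_injective {n p : ℕ} {V : Matrix (Fin n) (Fin n) ℝ}
    (hV : V ∈ Matrix.orthogonalGroup (Fin n) ℝ) : Function.Injective (leftMul p V) := by
  have hVV : V.transpose * V = 1 := (Matrix.mem_orthogonalGroup_iff' (Fin n) ℝ).mp hV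
  intro X Y hXY
  have h1 : V * Matrix.of (fun i j => X (i, j)) = V * Matrix.of fun i j => Y (i, j) := by
    ext i j
    rw [← leftMul_apply V X (i, j), hXY, leftMul_apply]
  have h2 := congrArg (V.transpose * ·) h1
  simp only [← Matrix.mul_assoc, hVV, Matrix.one_mul] at h2
  ext a
  exact congrFun (congrFun h2 a.1) a.2

theorem mul_mem_stiefel {n p : ℕ} {V : Matrix (Fin n) (Fin n) ℝ}
    (hV : V ∈ Matrix.orthogonalGroup (Fin n) ℝ) {U : Matrix (Fin n) (Fin p) ℝ}
    (hU : U ∈ stiefel n p) : V * U ∈ stiefel n p := by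
  have hVV : V.transpose * V = 1 := (Matrix.mem_orthogonalGroup_iff' (Fin n) ℝ).mp hV
  have hU1 : U.transpose * U = 1 := hU
  change (V * U).transpose * (V * U) = 1
  rw [Matrix.transpose_mul, Matrix.mul_assoc, ← Matrix.mul_assoc V.transpose, hVV, Matrix.one_mul,
    hU1]

theorem measurePreserving_leftMul_gaussMeasure {n p : ℕ} {V : Matrix (Fin n) (Fin n) ℝ}
    (hV : V ∈ Matrix.orthogonalGroup (Fin n) ℝ) :
    MeasurePreserving (leftMul p V) (gaussMeasure (Fin n × Fin p))
      (gaussMeasure (Fin n × Fin p)) := by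
  have hVV : V.transpose * V = 1 := (Matrix.mem_orthogonalGroup_iff' (Fin n) ℝ).mp hV
  have hm : Measurable (leftMul p V) := (leftMul p V).continuous_of_finiteDimensional.measurable
  have hdet : |LinearMap.det (leftMul p V)| = 1 := by
    rw [leftMul, LinearMap.det_toLin', Matrix.det_kronecker, Matrix.det_one, one_pow, mul_one,
      abs_pow, abs_det_eq_one_of_mem_orthogonalGroup hV, one_pow]
  have hdet0 : LinearMap.det (leftMul p V) ≠ 0 := by
    intro h0
    rw [h0, abs_zero] at hdet
    exact zero_ne_one hdet
  have hvol : MeasurePreserving (leftMul p V) volume volume := by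
    refine ⟨hm, ?_⟩
    rw [Measure.map_linearMap_addHaar_eq_smul_addHaar volume hdet0, abs_inv, hdet]
    simp
  have hw : ∀ X, gaussWeight (leftMul p V X) = gaussWeight X := by
    intro X
    have h1 := sum_sq_eq_trace (V * Matrix.of fun i j => X (i, j))
    rw [Matrix.transpose_mul, Matrix.mul_assoc, ← Matrix.mul_assoc V.transpose, hVV,
      Matrix.one_mul, ← sum_sq_eq_trace] at h1
    simp only [gaussWeight, leftMul_apply]
    rw [h1]
    rfl
  refine ⟨hm, ?_⟩
  ext A hA
  rw [Measure.map_apply hm hA, gaussMeasure, withDensity_apply _ (hm hA), withDensity_apply _ hA,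
    ← hvol.setLIntegral_comp_preimage hA continuous_gaussWeight.measurable]
  simp only [hw]

theorem qrMeasure_mul_preimage {n p : ℕ} (h : p ≤ n) {V : Matrix (Fin n) (Fin n) ℝ}
    (hV : V ∈ Matrix.orthogonalGroup (Fin n) ℝ) {A : Set (Matrix (Fin n) (Fin p) ℝ)}
    (hA : MeasurableSet A) : qrMeasure h ((fun U => V * U) ⁻¹' A) = qrMeasure h A := by
  have hVV : V * V.transpose = 1 := (Matrix.mem_orthogonalGroup_iff (Fin n) ℝ).mp hV
  have hVt : V.transpose ∈ Matrix.orthogonalGroup (Fin n) ℝ := by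
    rw [Matrix.mem_orthogonalGroup_iff']
    exact hVV
  have hcont : Continuous fun U : Matrix (Fin n) (Fin p) ℝ => V * U :=
    continuous_const.matrix_mul continuous_id
  rw [qrMeasure_apply h hA, qrMeasure_apply h (hcont.measurable hA),
    ← (measurePreserving_leftMul_gaussMeasure hV).measure_preimage
      (measurableSet_qrProd_image h hA).nullMeasurableSet]
  congr 2
  ext X
  constructor
  · rintro ⟨U, hU, t, ht, rfl⟩
    exact ⟨V * U, ⟨hU.1, mul_mem_stiefel hV hU.2⟩, t, ht, (leftMul_qrProd h V U t).symm⟩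
  · rintro ⟨U, hU, t, ht, heq⟩
    have h1 : V * (V.transpose * U) = U := by rw [← Matrix.mul_assoc, hVV, Matrix.one_mul]
    refine ⟨V.transpose * U, ⟨?_, mul_mem_stiefel hVt hU.2⟩, t, ht, ?_⟩
    · change V * (V.transpose * U) ∈ A
      rw [h1]
      exact hU.1
    · apply leftMul_injective hV
      rw [leftMul_qrProd, h1, heq]

theorem mem_stiefel_self_iff {n : ℕ} (U : Matrix (Fin n) (Fin n) ℝ) :
    U ∈ stiefel n n ↔ U ∈ Matrix.orthogonalGroup (Fin n) ℝ := by
  rw [Matrix.mem_orthogonalGroup_iff']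
  rfl

theorem measurableSet_orthogonalGroup (n : ℕ) :
    MeasurableSet {U : Matrix (Fin n) (Fin n) ℝ | U ∈ Matrix.orthogonalGroup (Fin n) ℝ} := by
  convert measurableSet_stiefel n n using 1
  ext U
  exact (mem_stiefel_self_iff U).symm

theorem isCompact_stiefel (n p : ℕ) : IsCompact (stiefel n p) := by
  have hsub : stiefel n p ⊆ Set.univ.pi fun _ => Set.univ.pi fun _ => Set.Icc (-1) 1 := by
    intro U hU i _ j _
    have h1 := congrFun (congrFun hU j) j
    rw [Matrix.mul_apply, Matrix.one_apply_eq] at h1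
    have h2 : U i j * U i j ≤ 1 := by
      rw [← h1]
      exact Finset.single_le_sum (f := fun k => U.transpose j k * U k j)
        (fun k _ => mul_self_nonneg (U k j)) (Finset.mem_univ i)
    exact abs_le.mp (abs_le_one_iff_mul_self_le_one.mpr h2)
  exact (isCompact_univ_pi fun _ => isCompact_univ_pi fun _ => isCompact_Icc).of_isClosed_subset
    (isClosed_stiefel n p) hsub

instance instCompactSpaceOrthogonalGroup (n : ℕ) :
    CompactSpace (Matrix.orthogonalGroup (Fin n) ℝ) := by
  have h1 : (Matrix.orthogonalGroup (Fin n) ℝ : Set (Matrix (Fin n) (Fin n) ℝ)) = stiefel n n := by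
    ext U
    exact (mem_stiefel_self_iff U).symm
  refine isCompact_iff_compactSpace.mp ?_
  rw [h1]
  exact isCompact_stiefel n n

theorem orthogonalMeasure_apply (n : ℕ) (A : Set (Matrix.orthogonalGroup (Fin n) ℝ)) :
    orthogonalMeasure n A = ENNReal.ofReal
      (multiGamma n ((n : ℝ) / 2) / (2 ^ n * Real.pi ^ ((n : ℝ) ^ 2 / 2))) *
        qrMeasure (le_refl n) (Subtype.val '' A) := by
  rw [orthogonalMeasure, Measure.smul_apply, smul_eq_mul, stiefelMeasure_eq_qrMeasure]
  congr 1
  exact (MeasurableEmbedding.subtype_coe (measurableSet_orthogonalGroup n)).comap_apply _ _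

theorem multiGamma_pos (n : ℕ) : 0 < multiGamma n ((n : ℝ) / 2) := by
  refine mul_pos (Real.rpow_pos_of_pos Real.pi_pos _)
    (Finset.prod_pos fun j _ => Real.Gamma_pos_of_pos ?_)
  rw [← sub_div]
  refine half_pos (sub_pos.mpr ?_)
  exact_mod_cast j.2

instance instIsProbabilityMeasureOrthogonalMeasure (n : ℕ) :
    IsProbabilityMeasure (orthogonalMeasure n) := by
  refine ⟨?_⟩
  have h1 : (Subtype.val '' (Set.univ : Set (Matrix.orthogonalGroup (Fin n) ℝ))) =
      Set.univ ∩ stiefel n n := by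
    ext U
    rw [Set.image_univ, Subtype.range_coe_subtype, Set.univ_inter]
    exact (mem_stiefel_self_iff U).symm
  have h2 := multiGamma_pos n
  rw [orthogonalMeasure_apply, h1, qrMeasure_inter_stiefel, qrMeasure_univ,
    ← ENNReal.ofReal_mul (by positivity), ← ENNReal.ofReal_one, sq]
  congr 1
  have h3 : (0 : ℝ) < Real.pi ^ ((n : ℝ) * n / 2) := Real.rpow_pos_of_pos Real.pi_pos _
  field_simp

instance instIsMulLeftInvariantOrthogonalMeasure (n : ℕ) :
    (orthogonalMeasure n).IsMulLeftInvariant := by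
  refine ⟨fun V => ?_⟩
  ext A hA
  rw [Measure.map_apply (measurable_const_mul V) hA, orthogonalMeasure_apply,
    orthogonalMeasure_apply]
  congr 1
  have hA' : MeasurableSet (Subtype.val '' A : Set (Matrix (Fin n) (Fin n) ℝ)) :=
    (measurableSet_orthogonalGroup n).subtype_image hA
  rw [← qrMeasure_mul_preimage (le_refl n) V.2 hA', ← qrMeasure_inter_stiefel _ (_ ⁻¹' _)]
  congr 1
  ext U
  constructor
  · rintro ⟨U, hU, rfl⟩
    exact ⟨⟨V * U, hU, rfl⟩, (mem_stiefel_self_iff _).mpr U.2⟩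
  · rintro ⟨⟨U', hU', heq⟩, hU⟩
    refine ⟨⟨U, (mem_stiefel_self_iff _).mp hU⟩, ?_, rfl⟩
    have : U' = V * ⟨U, (mem_stiefel_self_iff _).mp hU⟩ := Subtype.ext heq
    rwa [this] at hU'

instance instIsHaarMeasureOrthogonalMeasure (n : ℕ) : (orthogonalMeasure n).IsHaarMeasure :=
  Measure.isHaarMeasure_of_isCompact_nonempty_interior _ Set.univ isCompact_univ
    (by simp) (by simp) (by simp)

theorem orthogonalMeasure_map_mul_mul (n : ℕ) (V W : Matrix.orthogonalGroup (Fin n) ℝ) :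
    (orthogonalMeasure n).map (fun U => V * U * W) = orthogonalMeasure n := by
  have h1 : (orthogonalMeasure n).map (fun U => V * U * W) =
      (orthogonalMeasure n).map (fun U => U * W) := by
    conv_rhs => rw [← map_mul_left_eq_self (orthogonalMeasure n) V]
    rw [Measure.map_map (measurable_mul_const W) (measurable_const_mul V)]
    rfl
  rw [h1]
  have : IsProbabilityMeasure ((orthogonalMeasure n).map fun U => U * W) :=
    Measure.isProbabilityMeasure_map (measurable_mul_const W).aemeasurable
  have : ((orthogonalMeasure n).map fun U => U * W).IsHaarMeasure :=
    Measure.isHaarMeasure_of_isCompact_nonempty_interior _ Set.univ isCompact_univ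
      (by simp) (by simp) (by simp)
  exact Measure.isHaarMeasure_eq_of_isProbabilityMeasure _ _

end StiefelVolume

end

theorem mainTheorem7 (n p : ℕ) (h : p ≤ n) :
    (∀ (Ω : Set (StiefelVolume.Pairs n p → ℝ))
        (φ : (StiefelVolume.Pairs n p → ℝ) → Matrix (Fin n) (Fin p) ℝ),
        StiefelVolume.IsParam (StiefelVolume.stiefel n p) Ω φ →
        (StiefelVolume.stiefelMeasure h).restrict (φ '' Ω) =
          StiefelVolume.paramMeasure (StiefelVolume.stiefelDensity h) Ω φ) ∧
    StiefelVolume.stiefelMeasure h (StiefelVolume.stiefel n p) =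
      ENNReal.ofReal (2 ^ p * Real.pi ^ ((p : ℝ) * (n : ℝ) / 2) /
        StiefelVolume.multiGamma p ((n : ℝ) / 2)) ∧
    MeasureTheory.IsProbabilityMeasure (StiefelVolume.orthogonalMeasure n) ∧
    (StiefelVolume.orthogonalMeasure n).IsHaarMeasure ∧
    ∀ V W : Matrix.orthogonalGroup (Fin n) ℝ,
      (StiefelVolume.orthogonalMeasure n).map (fun U => V * U * W) =
        StiefelVolume.orthogonalMeasure n := by
  refine ⟨fun Ω φ hφ => ?_, ?_, inferInstance, inferInstance,
    StiefelVolume.orthogonalMeasure_map_mul_mul n⟩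
  · rw [StiefelVolume.stiefelMeasure_eq_qrMeasure]
    exact StiefelVolume.qrMeasure_restrict_image h hφ
  · rw [StiefelVolume.stiefelMeasure_eq_qrMeasure, ← StiefelVolume.qrMeasure_univ h,
      ← StiefelVolume.qrMeasure_inter_stiefel h Set.univ, Set.univ_inter]
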